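/- Let $0<b\le\infty$ and let $q$ be real-valued with $q\in L^1((0,c))$ for all finite $c\le b$. Solutions of $-u''+qu=zu$ on $[0,b)$ are functions $u$ with $u,u'$ locally absolutely continuous on $[0,b)$ that satisfy the equation almost everywhere. One of the following boundary conditions is fixed at $b$: (i) $b<\infty$: $u'(b_-)+hu(b_-)=0$ for some $h\in\mathbb R$, or $u(b_-)=0$ ("$h=\infty$"); (ii) $b=\infty$ and the equation is limit point at $\infty$ (for each $z$ with $\operatorname{Im}z>0$ there is, up to a constant factor, exactly one nonzero solution that is $L^2$ at $\infty$): $u$ is $L^2$ at $\infty$; (iii) $b=\infty$ and the equation is limit circle at $\infty$ (for each $z$ with $\operatorname{Im}z>0$ all solutions are $L^2$ at $\infty$): $\lim_{x\to\infty}[u_0(x)u'(x)-u_0'(x)u(x)]=0$, where $u_0$ is a fixed nonzero solution for $z=i$ which defines a self-adjoint boundary condition, i.e. $\lim_{x\to\infty}[\overline{u_0(x)}u_0'(x)-\overline{u_0'(x)}u_0(x)]=0$. For $\operatorname{Im}z>0$ the Weyl–Titchmarsh function is $m(z,x)=u'(x,z)/u(x,z)$, where $u(\cdot,z)$ is a nonzero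 solution satisfying the boundary condition at $b$. Theorem. Let $\varepsilon,\delta,K_0>0$ and $\eta\in\mathbb R$. There is a constant $C$, depending only on $\varepsilon,\delta,K_0$ and $\eta$, such that the following holds. Let $a\ge 0$, let $q$, $b$ and a boundary condition be as above with $a+\delta\le b$ (in particular $q\in L^1((0,a+\delta))$), and suppose that $$\sup_{0\le x\le a}\int_x^{x+\delta}|q(y)|\,dy\le\eta .$$ Then for all $\kappa\in\mathbb C$ with $\arg\kappa\in(-\frac{\pi}{2}+\varepsilon,-\varepsilon)$ and $|\kappa|\ge K_0$, every nonzero solution $u$ for $z=-\kappa^2$ satisfying the boundary condition at $b$, and all $x\in[0,a]$, one has $u(x)\neq0$ and $$|m(-\kappa^2,x)+\kappa|\le C .$$ -/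

import Mathlib

open MeasureTheory Set Filter Topology

/-- `u` solves `-u'' + q u = z u` on `[0, b)` (`b` finite or `⊤`), with derivative `du = u'`:
`u` is differentiable (one-sidedly at `0`) with `u' = du`, and `du` is the indefinite integral of
`(q - z) u`, that is, `u'` is locally absolutely continuous on `[0, b)` and the equation holds
almost everywhere.  Used for `q` that is integrable on `(0, c)` for all finite `c < b`. -/
structure IsSchrodingerSolution (q : ℝ → ℝ) (b : EReal) (z : ℂ) (u du : ℝ → ℂ) : Prop where
  hasDeriv : ∀ x : ℝ, 0 ≤ x → (x : EReal) < b → HasDerivWithinAt u (du x) (Ici 0) x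
  equation : ∀ x : ℝ, 0 ≤ x → (x : EReal) < b →
    du x = du 0 + ∫ t in (0 : ℝ)..x, ((q t : ℂ) - z) * u t

/-- `u` does not vanish identically on `[0, b)`. -/
def IsNontrivialOn (b : EReal) (u : ℝ → ℂ) : Prop :=
  ∃ x : ℝ, 0 ≤ x ∧ (x : EReal) < b ∧ u x ≠ 0

/-- Square integrability on `(0, ∞)`; for a solution on `[0, ∞)`, which is continuous there, this is
the same as being `L²` at infinity. -/
def IsSquareIntegrable (u : ℝ → ℂ) : Prop :=
  IntegrableOn (fun x => ‖u x‖ ^ 2) (Ioi 0)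

/-- The limit point case at infinity: for every `z` in the upper half-plane there is, up to a
multiplicative constant, exactly one nonzero solution that is `L²` at infinity. -/
def IsLimitPoint (q : ℝ → ℝ) : Prop :=
  ∀ z : ℂ, 0 < z.im → ∃ u du : ℝ → ℂ,
    IsSchrodingerSolution q ⊤ z u du ∧ IsNontrivialOn ⊤ u ∧ IsSquareIntegrable u ∧
    ∀ w dw : ℝ → ℂ, IsSchrodingerSolution q ⊤ z w dw → IsSquareIntegrable w →
      ∃ c : ℂ, ∀ x : ℝ, 0 ≤ x → w x = c * u x

/-- The limit circle case at infinity: for every `z` in the upper half-plane all solutions are `L²`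
at infinity. -/
def IsLimitCircle (q : ℝ → ℝ) : Prop :=
  ∀ z : ℂ, 0 < z.im → ∀ u du : ℝ → ℂ,
    IsSchrodingerSolution q ⊤ z u du → IsSquareIntegrable u

/-- The right endpoint of the half-line problem together with the boundary condition there. -/
inductive RightEnd where
  /-- `b < ∞` with `u'(b-) + h u(b-) = 0`, `h` real. -/
  | robin (b h : ℝ)
  /-- `b < ∞` with `u(b-) = 0` (the case `h = ∞`). -/
  | dirichlet (b : ℝ)
  /-- `b = ∞`, limit point case: no boundary condition but square integrability. -/
  | limitPoint
  /-- `b = ∞`, limit circle case, with the boundary condition given by a solution `u₀`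
  (with derivative `du₀`) of the equation with `z = i`. -/
  | limitCircle (u₀ du₀ : ℝ → ℂ)

namespace RightEnd

/-- The right endpoint `b ≤ ∞`. -/
noncomputable def point : RightEnd → EReal
  | robin b _ => (b : EReal)
  | dirichlet b => (b : EReal)
  | limitPoint => ⊤
  | limitCircle _ _ => ⊤

/-- The assumptions on the potential `q` (and on `u₀`) in the respective case.  In the limit circle
case the last conjunct says that `u₀` defines a self-adjoint boundary condition at infinity, i.e.
that the Wronskian of `u₀` and its complex conjugate tends to zero. -/
def Admissible (q : ℝ → ℝ) : RightEnd → Prop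
  | robin b _ => IntegrableOn q (Ioo 0 b)
  | dirichlet b => IntegrableOn q (Ioo 0 b)
  | limitPoint => (∀ c : ℝ, IntegrableOn q (Ioo 0 c)) ∧ IsLimitPoint q
  | limitCircle u₀ du₀ => (∀ c : ℝ, IntegrableOn q (Ioo 0 c)) ∧ IsLimitCircle q ∧
      IsSchrodingerSolution q ⊤ Complex.I u₀ du₀ ∧ IsNontrivialOn ⊤ u₀ ∧
      Tendsto (fun x => star (u₀ x) * du₀ x - star (du₀ x) * u₀ x) atTop (𝓝 0)

/-- The boundary condition at the right endpoint for a solution `u` with derivative `du`. -/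
def Condition (u du : ℝ → ℂ) : RightEnd → Prop
  | robin b h => Tendsto (fun x => du x + (h : ℂ) * u x) (𝓝[<] b) (𝓝 0)
  | dirichlet b => Tendsto u (𝓝[<] b) (𝓝 0)
  | limitPoint => IsSquareIntegrable u
  | limitCircle u₀ du₀ => Tendsto (fun x => u₀ x * du x - du₀ x * u x) atTop (𝓝 0)

end RightEnd

/-- `u` (with derivative `du`) is a nonzero solution of `-u'' + q u = z u` on `[0, b)` that satisfies
the boundary condition at the right endpoint.  The Weyl-Titchmarsh `m`-function is
`m(z, x) = u'(x) / u(x) = du x / u x` for any such `u`. -/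
structure IsWeylSolution (q : ℝ → ℝ) (B : RightEnd) (z : ℂ) (u du : ℝ → ℂ) : Prop where
  solution : IsSchrodingerSolution q B.point z u du
  nontrivial : IsNontrivialOn B.point u
  condition : B.Condition u du

/-! Everything rests on the sign of W = Im(ū u'). Since W decreases at rate Im z |u|², it is
nonnegative as soon as it is so towards b, and this is what the boundary condition provides
(`IsWeylSolution.exists_global`). At a finite b one has W(b) = 0. In the limit point case u is a
multiple of Weyl's solution, a limit of solutions vanishing at points tending to infinity. In the
limit circle case W tends to 0, by identities between Wronskians.

From W ≥ 0 and Im κ < 0 follows |u' - κu| ≥ |Im κ| |u|. Hence ρ = (u' + κu)/(u' - κu) is bounded in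
terms of ε, and it satisfies ρ' = 2κρ - 2κq (u/(u' - κu))². Integrating this over [x, x + δ] with
the factor exp(-2κt) yields ρ(x) = O(1/|κ|) (`norm_add_le_mul_norm_sub`). For large |κ|, inverting
the Möbius map m ↦ ρ bounds m + κ.

For the remaining bounded range of |κ|, W(x) dominates Im z times the mass of |u|² on a short
interval. If u'(x) were large compared to u(x), then |u| would grow linearly there and the mass
would be of order |u'(x)|², whereas W(x) ≤ |u(x)| |u'(x)|. This bounds m itself (`norm_deriv_le`).
-/

/-! ### Calculus of complex-valued absolutely continuous functions. -/

/-- A function whose increments are dominated by those of an absolutely continuous function is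
absolutely continuous. -/
theorem AbsolutelyContinuousOnInterval.of_dist_le {X Y : Type*} [PseudoMetricSpace X]
    [PseudoMetricSpace Y] {f : ℝ → X} {g : ℝ → Y} {a b K : ℝ}
    (hf : AbsolutelyContinuousOnInterval f a b)
    (h : ∀ x ∈ uIcc a b, ∀ y ∈ uIcc a b, dist (g x) (g y) ≤ K * dist (f x) (f y)) :
    AbsolutelyContinuousOnInterval g a b := by
  have h0 := Tendsto.const_mul K hf
  rw [mul_zero] at h0
  refine squeeze_zero' (Eventually.of_forall fun t => Finset.sum_nonneg fun i _ => dist_nonneg) ?_ h0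
  rw [eventually_inf_principal]
  refine Eventually.of_forall fun E hE => ?_
  rw [Finset.mul_sum]
  exact Finset.sum_le_sum fun i hi => h _ (hE.1 i hi).1 _ (hE.1 i hi).2

/-- `F` is absolutely continuous between `a` and `b`, with almost everywhere derivative `f`. -/
structure HasACDeriv (F f : ℝ → ℂ) (a b : ℝ) : Prop where
  ac : AbsolutelyContinuousOnInterval F a b
  integrable : IntervalIntegrable f volume a b
  deriv : ∀ᵐ x, x ∈ uIcc a b → HasDerivAt F (f x) x

namespace HasACDeriv

variable {F G f g : ℝ → ℂ} {a b : ℝ}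

theorem continuousOn (h : HasACDeriv F f a b) : ContinuousOn F (uIcc a b) := h.ac.continuousOn

/-- The fundamental theorem of calculus. -/
theorem integral_eq (h : HasACDeriv F f a b) : ∫ x in a..b, f x = F b - F a := by
  -- The real-valued theorem is applied to `L ∘ F`; real and imaginary part suffice.
  have key : ∀ L : ℂ →L[ℝ] ℝ, L (∫ x in a..b, f x) = L (F b) - L (F a) := by
    intro L
    have hac : AbsolutelyContinuousOnInterval (fun x => L (F x)) a b :=
      h.ac.of_dist_le (K := ‖L‖) fun x _ y _ => by
        rw [dist_eq_norm, dist_eq_norm, ← map_sub]; exact L.le_opNorm _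
    rw [← hac.integral_deriv_eq_sub, ← L.intervalIntegral_comp_comm h.integrable]
    refine intervalIntegral.integral_congr_ae ?_
    filter_upwards [h.deriv] with x hx hx'
    exact (L.hasFDerivAt.comp_hasDerivAt x (hx (uIoc_subset_uIcc hx'))).deriv.symm
  refine Complex.ext ?_ ?_
  · simpa using key Complex.reCLM
  · simpa using key Complex.imCLM

theorem congr_deriv (h : HasACDeriv F f a b) (hfg : ∀ x ∈ uIcc a b, f x = g x) :
    HasACDeriv F g a b := by
  refine ⟨h.ac, h.integrable.congr fun x hx => hfg x (uIoc_subset_uIcc hx), ?_⟩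
  filter_upwards [h.deriv] with x hx hx'
  rw [← hfg x hx']
  exact hx hx'

theorem add (hF : HasACDeriv F f a b) (hG : HasACDeriv G g a b) :
    HasACDeriv (fun x => F x + G x) (fun x => f x + g x) a b := by
  refine ⟨hF.ac.fun_add hG.ac, hF.integrable.add hG.integrable, ?_⟩
  filter_upwards [hF.deriv, hG.deriv] with x h1 h2 hx
  exact (h1 hx).add (h2 hx)

theorem mul (hF : HasACDeriv F f a b) (hG : HasACDeriv G g a b) :
    HasACDeriv (fun x => F x * G x) (fun x => f x * G x + F x * g x) a b := by
  refine ⟨hF.ac.fun_smul hG.ac, ?_, ?_⟩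
  · exact (hF.integrable.mul_continuousOn hG.continuousOn).add
      (hG.integrable.continuousOn_mul hF.continuousOn)
  · filter_upwards [hF.deriv, hG.deriv] with x h1 h2 hx
    exact (h1 hx).mul (h2 hx)

theorem inv (hF : HasACDeriv F f a b) (h0 : ∀ x ∈ uIcc a b, F x ≠ 0) :
    HasACDeriv (fun x => (F x)⁻¹) (fun x => -f x / F x ^ 2) a b := by
  have hc : ContinuousOn (fun x => (F x)⁻¹) (uIcc a b) := hF.continuousOn.inv₀ h0
  obtain ⟨C, hC⟩ := isCompact_uIcc.exists_bound_of_continuousOn hc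
  -- If |1/F| ≤ C, then |1/F(x) - 1/F(y)| ≤ C² |F(x) - F(y)|.
  refine ⟨hF.ac.of_dist_le (K := C * C) fun x hx y hy => ?_, ?_, ?_⟩
  · rw [dist_eq_norm, dist_eq_norm, inv_sub_inv (h0 x hx) (h0 y hy), div_eq_mul_inv, mul_inv,
      norm_mul, norm_mul, norm_sub_rev, mul_comm]
    exact mul_le_mul_of_nonneg_right (mul_le_mul (hC x hx) (hC y hy) (norm_nonneg _)
      ((norm_nonneg _).trans (hC x hx))) (norm_nonneg _)
  · have := (hF.integrable.mul_continuousOn (hc.mul hc)).neg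
    refine this.congr fun x _ => ?_
    simp only [Pi.neg_apply, Pi.mul_apply]
    ring
  · filter_upwards [hF.deriv] with x h1 hx
    exact (h1 hx).inv (h0 x hx)

theorem const_mul (c : ℂ) (hF : HasACDeriv F f a b) :
    HasACDeriv (fun x => c * F x) (fun x => c * f x) a b := by
  refine ⟨hF.ac.const_smul c, hF.integrable.const_mul c, ?_⟩
  filter_upwards [hF.deriv] with x h1 hx
  exact (h1 hx).const_mul c

/-- The indefinite integral of an interval integrable function. -/
theorem of_integral (hf : IntervalIntegrable f volume a b)
    (hF : ∀ x, F x = F a + ∫ t in a..x, f t) : HasACDeriv F f a b := by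
  have hsub : ∀ x ∈ uIcc a b, IntervalIntegrable f volume a x := fun x hx =>
    hf.mono_set (uIcc_subset_uIcc_left hx)
  refine ⟨(hf.norm.absolutelyContinuousOnInterval_intervalIntegral
    (c := a) left_mem_uIcc).of_dist_le (K := 1) fun x hx y hy => ?_, hf, ?_⟩
  · rw [one_mul, dist_comm, dist_comm (∫ v in a..x, ‖f v‖), dist_eq_norm, dist_eq_norm, hF x, hF y,
      add_sub_add_left_eq_sub, intervalIntegral.integral_interval_sub_left (hsub y hy) (hsub x hx),
      intervalIntegral.integral_interval_sub_left (hsub y hy).norm (hsub x hx).norm, Real.norm_eq_abs]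
    exact intervalIntegral.norm_integral_le_abs_integral_norm
  · filter_upwards [hf.ae_hasDerivAt_integral] with x h1 hx
    have := (h1 hx a left_mem_uIcc).const_add (F a)
    rwa [show (fun y => F a + ∫ t in a..y, f t) = F from funext fun y => (hF y).symm] at this

theorem of_hasDerivAt (hF : ∀ x, HasDerivAt F (f x) x) (hf : Continuous f) :
    HasACDeriv F f a b := by
  refine of_integral (hf.intervalIntegrable _ _) fun x => ?_
  rw [intervalIntegral.integral_eq_sub_of_hasDerivAt (fun t _ => hF t) (hf.intervalIntegrable _ _)]
  ring

end HasACDeriv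

/-- `∫₀ˣ p Pⁿ = Pⁿ⁺¹ / (n + 1)` for the indefinite integral `P` of `p`. -/
theorem integral_mul_primitive_pow {p : ℝ → ℝ} (hp : ∀ a b, IntervalIntegrable p volume a b)
    (n : ℕ) (x : ℝ) :
    ∫ t in (0 : ℝ)..x, p t * (∫ s in (0 : ℝ)..t, p s) ^ n =
      (∫ s in (0 : ℝ)..x, p s) ^ (n + 1) / (n + 1) := by
  set P : ℝ → ℂ := fun t => ∫ s in (0 : ℝ)..t, (p s : ℂ) with hP
  have hPr : ∀ t, P t = ((∫ s in (0 : ℝ)..t, p s : ℝ) : ℂ) := fun t =>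
    intervalIntegral.integral_ofReal
  have h1 : HasACDeriv P (fun t => (p t : ℂ)) 0 x :=
    .of_integral ⟨(hp 0 x).1.ofReal, (hp 0 x).2.ofReal⟩ fun t => by simp [hP]
  have h2 : ∀ n : ℕ, HasACDeriv (fun t => P t ^ (n + 1)) (fun t => (n + 1) * (p t * P t ^ n)) 0 x := by
    intro n
    induction n with
    | zero => simpa using h1
    | succ n ih =>
      have := (ih.mul h1).congr_deriv
        (g := fun t => ((n + 1 : ℕ) + 1) * (p t * P t ^ (n + 1))) fun t _ => by push_cast; ring
      simpa only [← pow_succ] using this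
  have h3 := (h2 n).integral_eq
  rw [intervalIntegral.integral_const_mul] at h3
  have h4 : P 0 = 0 := by simp [hP]
  rw [h4, zero_pow (Nat.succ_ne_zero n), sub_zero] at h3
  simp only [hPr] at h3
  have h5 : ∫ t in (0 : ℝ)..x, (p t : ℂ) * ((∫ s in (0 : ℝ)..t, p s : ℝ) : ℂ) ^ n =
      ((∫ t in (0 : ℝ)..x, p t * (∫ s in (0 : ℝ)..t, p s) ^ n : ℝ) : ℂ) := by
    rw [← intervalIntegral.integral_ofReal]; simp
  rw [h5] at h3
  rw [eq_div_iff (by positivity), mul_comm]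
  exact_mod_cast h3

/-! ### Solutions on the whole line and their Wronskians. -/

/-- `u` solves `u'' = p u` on the whole line, with derivative `du`. -/
structure IsGlobalSolution (p : ℝ → ℂ) (u du : ℝ → ℂ) : Prop where
  hasDerivAt : ∀ x, HasDerivAt u (du x) x
  equation : ∀ x, du x = du 0 + ∫ t in (0 : ℝ)..x, p t * u t

namespace IsGlobalSolution

variable {p r u du v dv : ℝ → ℂ}

theorem continuous (h : IsGlobalSolution p u du) : Continuous u :=
  continuous_iff_continuousAt.2 fun x => (h.hasDerivAt x).continuousAt

theorem intervalIntegrable (hp : ∀ a b, IntervalIntegrable p volume a b)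
    (h : IsGlobalSolution p u du) (a b : ℝ) : IntervalIntegrable (fun t => p t * u t) volume a b :=
  (hp a b).mul_continuousOn h.continuous.continuousOn

theorem deriv_eq (hp : ∀ a b, IntervalIntegrable p volume a b) (h : IsGlobalSolution p u du)
    (x y : ℝ) : du y = du x + ∫ t in x..y, p t * u t := by
  rw [h.equation y, h.equation x, add_assoc, intervalIntegral.integral_add_adjacent_intervals
    (h.intervalIntegrable hp _ _) (h.intervalIntegrable hp _ _)]

theorem continuous_deriv (hp : ∀ a b, IntervalIntegrable p volume a b)
    (h : IsGlobalSolution p u du) : Continuous du := by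
  rw [show du = fun x => du 0 + ∫ t in (0 : ℝ)..x, p t * u t from funext h.equation]
  exact continuous_const.add
    (intervalIntegral.continuous_primitive (fun a b => h.intervalIntegrable hp a b) 0)

theorem hasACDeriv (hp : ∀ a b, IntervalIntegrable p volume a b) (h : IsGlobalSolution p u du)
    (a b : ℝ) : HasACDeriv u du a b :=
  .of_hasDerivAt h.hasDerivAt (h.continuous_deriv hp)

theorem hasACDeriv_deriv (hp : ∀ a b, IntervalIntegrable p volume a b)
    (h : IsGlobalSolution p u du) (a b : ℝ) : HasACDeriv du (fun t => p t * u t) a b :=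
  .of_integral (h.intervalIntegrable hp a b) fun x => h.deriv_eq hp a x

theorem conj (hp : ∀ a b, IntervalIntegrable p volume a b) (h : IsGlobalSolution p u du) :
    IsGlobalSolution (fun t => star (p t)) (fun t => star (u t)) (fun t => star (du t)) := by
  refine ⟨fun x => (h.hasDerivAt x).star, fun x => ?_⟩
  rw [h.equation x, star_add]
  congr 1
  simp_rw [← star_mul']
  exact (Complex.conjCLE.toContinuousLinearMap.intervalIntegral_comp_comm
    (h.intervalIntegrable hp 0 x)).symm

theorem add (hp : ∀ a b, IntervalIntegrable p volume a b) (h : IsGlobalSolution p u du)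
    (h' : IsGlobalSolution p v dv) :
    IsGlobalSolution p (fun t => u t + v t) (fun t => du t + dv t) := by
  refine ⟨fun x => (h.hasDerivAt x).add (h'.hasDerivAt x), fun x => ?_⟩
  simp_rw [mul_add]
  rw [intervalIntegral.integral_add (h.intervalIntegrable hp 0 x) (h'.intervalIntegrable hp 0 x),
    h.equation x, h'.equation x]
  ring

theorem const_mul (c : ℂ) (h : IsGlobalSolution p u du) :
    IsGlobalSolution p (fun t => c * u t) (fun t => c * du t) := by
  refine ⟨fun x => (h.hasDerivAt x).const_mul c, fun x => ?_⟩
  simp_rw [mul_left_comm (p _) c]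
  rw [intervalIntegral.integral_const_mul, h.equation x]
  ring

/-- Lagrange's identity for the Wronskian of solutions of two equations. -/
theorem wronskian_sub (hp : ∀ a b, IntervalIntegrable p volume a b)
    (hr : ∀ a b, IntervalIntegrable r volume a b) (h : IsGlobalSolution p u du)
    (h' : IsGlobalSolution r v dv) (x y : ℝ) :
    (u y * dv y - du y * v y) - (u x * dv x - du x * v x) =
      ∫ t in x..y, (r t - p t) * (u t * v t) := by
  -- In the derivative of u v' - u' v the two terms u' v' cancel.
  have h1 := ((h.hasACDeriv hp x y).mul (h'.hasACDeriv_deriv hr x y)).add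
    (((h.hasACDeriv_deriv hp x y).mul (h'.hasACDeriv hr x y)).const_mul (-1))
  have h2 := (h1.congr_deriv (g := fun t => (r t - p t) * (u t * v t)) fun t _ => by ring).integral_eq
  rw [h2]
  ring

theorem wronskian_eq (hp : ∀ a b, IntervalIntegrable p volume a b) (h : IsGlobalSolution p u du)
    (h' : IsGlobalSolution p v dv) (x y : ℝ) :
    u y * dv y - du y * v y = u x * dv x - du x * v x := by
  have := h.wronskian_sub hp hp h' x y
  simp only [sub_self, zero_mul, intervalIntegral.integral_zero] at this
  exact sub_eq_zero.1 this

end IsGlobalSolution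

/-! ### The Volterra equation. -/

/-- The terms of the Neumann series for the Volterra equation
`u(x) = f(x) + ∫₀ˣ ∫₀ˢ p(t) u(t) dt ds`. -/
noncomputable def volterraTerm (p f : ℝ → ℂ) : ℕ → ℝ → ℂ
  | 0 => f
  | n + 1 => fun x => ∫ s in (0 : ℝ)..x, ∫ t in (0 : ℝ)..s, p t * volterraTerm p f n t

section Volterra

variable {p f : ℝ → ℂ} {c M : ℝ} {n : ℕ}

theorem primitive_norm_nonneg {x : ℝ} (hx : 0 ≤ x) : 0 ≤ ∫ t in (0 : ℝ)..x, ‖p t‖ :=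
  intervalIntegral.integral_nonneg hx fun _ _ => norm_nonneg _

theorem primitive_norm_mono (hp : ∀ a b, IntervalIntegrable p volume a b) {x y : ℝ} (hx : 0 ≤ x)
    (hxy : x ≤ y) : ∫ t in (0 : ℝ)..x, ‖p t‖ ≤ ∫ t in (0 : ℝ)..y, ‖p t‖ :=
  intervalIntegral.integral_mono_interval le_rfl hx hxy
    (Eventually.of_forall fun _ => norm_nonneg _) (hp 0 y).norm

/-- With P the primitive of ‖p‖, integrating ‖p‖ Pⁿ gives Pⁿ⁺¹/(n + 1). This produces the factorial
that makes the Neumann series converge. -/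
theorem norm_integral_le_pow_div_factorial (hp : ∀ a b, IntervalIntegrable p volume a b)
    (hf : ∀ x ∈ Icc 0 c, ‖f x‖ ≤ M * (c * ∫ t in (0 : ℝ)..x, ‖p t‖) ^ n / n.factorial) {x : ℝ}
    (hx : x ∈ Icc 0 c) :
    ‖∫ t in (0 : ℝ)..x, p t * f t‖ ≤
      M * c ^ n * (∫ t in (0 : ℝ)..x, ‖p t‖) ^ (n + 1) / (n + 1).factorial := by
  have hP : ContinuousOn (fun t : ℝ => (∫ s in (0 : ℝ)..t, ‖p s‖) ^ n) (uIcc 0 x) :=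
    ((intervalIntegral.continuous_primitive (fun a b => (hp a b).norm) 0).pow n).continuousOn
  calc ‖∫ t in (0 : ℝ)..x, p t * f t‖
      ≤ ∫ t in (0 : ℝ)..x, (M * c ^ n / n.factorial) * (‖p t‖ * (∫ s in (0 : ℝ)..t, ‖p s‖) ^ n) := by
        refine intervalIntegral.norm_integral_le_of_norm_le hx.1
          (Eventually.of_forall fun t ht => ?_)
          (((hp 0 x).norm.mul_continuousOn hP).const_mul _)
        rw [norm_mul]
        refine (mul_le_mul_of_nonneg_left (hf t ⟨ht.1.le, ht.2.trans hx.2⟩) (norm_nonneg _)).trans_eq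
          ?_
        rw [mul_pow]
        ring
    _ = _ := by
        rw [intervalIntegral.integral_const_mul, integral_mul_primitive_pow fun a b => (hp a b).norm,
          Nat.factorial_succ]
        push_cast
        field_simp

theorem norm_integral_integral_le_pow_div_factorial
    (hp : ∀ a b, IntervalIntegrable p volume a b) (hM : 0 ≤ M)
    (hf : ∀ x ∈ Icc 0 c, ‖f x‖ ≤ M * (c * ∫ t in (0 : ℝ)..x, ‖p t‖) ^ n / n.factorial) {x : ℝ}
    (hx : x ∈ Icc 0 c) :
    ‖∫ s in (0 : ℝ)..x, ∫ t in (0 : ℝ)..s, p t * f t‖ ≤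
      M * (c * ∫ t in (0 : ℝ)..x, ‖p t‖) ^ (n + 1) / (n + 1).factorial := by
  have hc : 0 ≤ c := hx.1.trans hx.2
  have hP := primitive_norm_nonneg (p := p) hx.1
  have h1 : ‖∫ s in (0 : ℝ)..x, ∫ t in (0 : ℝ)..s, p t * f t‖ ≤
      (M * c ^ n * (∫ t in (0 : ℝ)..x, ‖p t‖) ^ (n + 1) / (n + 1).factorial) * |x - 0| := by
    refine intervalIntegral.norm_integral_le_of_norm_le_const fun s hs => ?_
    rw [uIoc_of_le hx.1] at hs
    refine (norm_integral_le_pow_div_factorial hp hf ⟨hs.1.le, hs.2.trans hx.2⟩).trans ?_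
    have := primitive_norm_nonneg (p := p) hs.1.le
    have := primitive_norm_mono hp hs.1.le hs.2
    gcongr
  refine h1.trans ?_
  rw [sub_zero, abs_of_nonneg hx.1, mul_pow, pow_succ c, div_mul_eq_mul_div]
  gcongr ?_ / _
  have : 0 ≤ M * c ^ n * (∫ t in (0 : ℝ)..x, ‖p t‖) ^ (n + 1) := by positivity
  calc _ ≤ M * c ^ n * (∫ t in (0 : ℝ)..x, ‖p t‖) ^ (n + 1) * c :=
        mul_le_mul_of_nonneg_left hx.2 this
    _ = _ := by ring

/-- The homogeneous Volterra equation has only the zero solution. -/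
theorem eq_zero_of_volterra (hp : ∀ a b, IntervalIntegrable p volume a b)
    (hfc : ContinuousOn f (Icc 0 c))
    (hf : ∀ x ∈ Icc 0 c, f x = ∫ s in (0 : ℝ)..x, ∫ t in (0 : ℝ)..s, p t * f t) :
    ∀ x ∈ Icc 0 c, f x = 0 := by
  intro x hx
  obtain ⟨M, hM⟩ := isCompact_Icc.exists_bound_of_continuousOn hfc
  have hM0 : 0 ≤ M := (norm_nonneg _).trans (hM x hx)
  -- Reinserting the bound into the equation makes f smaller than every term of an exponential
  -- series.
  have hb : ∀ n : ℕ, ∀ y ∈ Icc 0 c,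
      ‖f y‖ ≤ M * (c * ∫ t in (0 : ℝ)..y, ‖p t‖) ^ n / n.factorial := by
    intro n
    induction n with
    | zero => simpa using hM
    | succ n ih =>
      intro y hy
      rw [hf y hy]
      exact norm_integral_integral_le_pow_div_factorial hp hM0 ih hy
  have ht := (FloorSemiring.tendsto_pow_div_factorial_atTop
    (c * ∫ t in (0 : ℝ)..x, ‖p t‖)).const_mul M
  rw [mul_zero] at ht
  have := ge_of_tendsto' ht fun n => by
    rw [← mul_div_assoc]; exact hb n x hx
  exact norm_le_zero_iff.1 this

theorem continuous_volterraTerm (hp : ∀ a b, IntervalIntegrable p volume a b) (hf : Continuous f)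
    (n : ℕ) : Continuous (volterraTerm p f n) := by
  induction n with
  | zero => exact hf
  | succ n ih =>
    refine intervalIntegral.continuous_primitive (fun a b => ?_) 0
    exact (intervalIntegral.continuous_primitive
      (fun a b => (hp a b).mul_continuousOn ih.continuousOn) 0).intervalIntegrable _ _

theorem norm_volterraTerm_le (hp : ∀ a b, IntervalIntegrable p volume a b) (hM : 0 ≤ M)
    (hf : ∀ x ∈ Icc 0 c, ‖f x‖ ≤ M) (n : ℕ) : ∀ x ∈ Icc 0 c,
      ‖volterraTerm p f n x‖ ≤ M * (c * ∫ t in (0 : ℝ)..x, ‖p t‖) ^ n / n.factorial := by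
  induction n with
  | zero => simpa [volterraTerm] using hf
  | succ n ih => exact fun x hx => norm_integral_integral_le_pow_div_factorial hp hM ih hx

/-- The Volterra equation is solved by its Neumann series. -/
theorem exists_volterra_solution (hp : ∀ a b, IntervalIntegrable p volume a b) (hf : Continuous f) :
    ∃ F : ℝ → ℂ, (∀ c, ContinuousOn F (Icc 0 c)) ∧
      ∀ x, 0 ≤ x → F x = f x + ∫ s in (0 : ℝ)..x, ∫ t in (0 : ℝ)..s, p t * F t := by
  set F : ℝ → ℂ := fun x => ∑' n, volterraTerm p f n x with hF
  have key : ∀ c : ℝ, ∃ M : ℝ, ∃ R : ℝ, ∀ n, ∀ x ∈ Icc 0 c,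
      ‖volterraTerm p f n x‖ ≤ M * (R ^ n / n.factorial) := by
    intro c
    obtain ⟨M, hM⟩ := isCompact_Icc.exists_bound_of_continuousOn (hf.continuousOn (s := Icc 0 c))
    refine ⟨max M 0, c * ∫ t in (0 : ℝ)..c, ‖p t‖, fun n x hx => ?_⟩
    refine (norm_volterraTerm_le hp (le_max_right M 0)
      (fun y hy => (hM y hy).trans (le_max_left _ _)) n x hx).trans ?_
    rw [mul_div_assoc]
    have := primitive_norm_nonneg (p := p) hx.1
    have := primitive_norm_mono hp hx.1 hx.2
    have := hx.1.trans hx.2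
    have : 0 ≤ max M 0 := le_max_right _ _
    gcongr
  have hsumm : ∀ M R : ℝ, Summable fun n : ℕ => M * (R ^ n / n.factorial) := fun M R =>
    (Real.summable_pow_div_factorial R).mul_left M
  have hFc : ∀ c, ContinuousOn F (Icc 0 c) := fun c => by
    obtain ⟨M, R, h⟩ := key c
    exact continuousOn_tsum (fun n => (continuous_volterraTerm hp hf n).continuousOn) (hsumm M R) h
  have hFs : ∀ x, 0 ≤ x → HasSum (fun n => volterraTerm p f n x) (F x) := fun x hx => by
    obtain ⟨M, R, h⟩ := key x
    exact (Summable.of_norm_bounded (hsumm M R) fun n => h n x ⟨hx, le_rfl⟩).hasSum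
  have hinner : ∀ s, 0 ≤ s → HasSum (fun n => ∫ t in (0 : ℝ)..s, p t * volterraTerm p f n t)
      (∫ t in (0 : ℝ)..s, p t * F t) := by
    intro s hs
    obtain ⟨M, R, h⟩ := key s
    refine intervalIntegral.hasSum_integral_of_dominated_convergence
      (fun n t => ‖p t‖ * (M * (R ^ n / n.factorial))) (fun n => ?_) (fun n => ?_) ?_ ?_ ?_
    · exact ((hp 0 s).mul_continuousOn
        (continuous_volterraTerm hp hf n).continuousOn).def'.aestronglyMeasurable
    · refine Eventually.of_forall fun t ht => ?_
      rw [uIoc_of_le hs] at ht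
      rw [norm_mul]
      exact mul_le_mul_of_nonneg_left (h n t ⟨ht.1.le, ht.2⟩) (norm_nonneg _)
    · exact Eventually.of_forall fun t _ => (hsumm M R).mul_left _
    · simp_rw [tsum_mul_left]
      exact (hp 0 s).norm.mul_const _
    · refine Eventually.of_forall fun t ht => ?_
      rw [uIoc_of_le hs] at ht
      exact (hFs t ht.1.le).mul_left _
  refine ⟨F, hFc, fun x hx => ?_⟩
  have houter : HasSum (fun n => volterraTerm p f (n + 1) x)
      (∫ s in (0 : ℝ)..x, ∫ t in (0 : ℝ)..s, p t * F t) := by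
    obtain ⟨M, R, h⟩ := key x
    refine intervalIntegral.hasSum_integral_of_dominated_convergence
      (fun n _ => (∫ t in (0 : ℝ)..x, ‖p t‖) * (M * (R ^ n / n.factorial)))
      (fun n => ?_) (fun n => ?_) ?_ ?_ ?_
    · exact (intervalIntegral.continuous_primitive (fun a b => (hp a b).mul_continuousOn
        (continuous_volterraTerm hp hf n).continuousOn) 0).aestronglyMeasurable
    · refine Eventually.of_forall fun s hs => ?_
      rw [uIoc_of_le hx] at hs
      have hK : 0 ≤ M * (R ^ n / n.factorial) :=
        (norm_nonneg _).trans (h n 0 ⟨le_rfl, hx⟩)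
      calc ‖∫ t in (0 : ℝ)..s, p t * volterraTerm p f n t‖
          ≤ ∫ t in (0 : ℝ)..s, ‖p t‖ * (M * (R ^ n / n.factorial)) := by
            refine intervalIntegral.norm_integral_le_of_norm_le hs.1.le
              (Eventually.of_forall fun t ht => ?_) ((hp 0 s).norm.mul_const _)
            rw [norm_mul]
            exact mul_le_mul_of_nonneg_left (h n t ⟨ht.1.le, ht.2.trans hs.2⟩) (norm_nonneg _)
        _ = (∫ t in (0 : ℝ)..s, ‖p t‖) * (M * (R ^ n / n.factorial)) :=
            intervalIntegral.integral_mul_const _ _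
        _ ≤ _ := mul_le_mul_of_nonneg_right (primitive_norm_mono hp hs.1.le hs.2) hK
    · exact Eventually.of_forall fun s _ => (hsumm M R).mul_left _
    · exact intervalIntegrable_const
    · refine Eventually.of_forall fun s hs => ?_
      rw [uIoc_of_le hx] at hs
      exact hinner s hs.1.le
  exact (hFs x hx).unique (HasSum.zero_add (f := fun n => volterraTerm p f n x) houter)

end Volterra

/-! ### The initial value problem. -/

namespace IsGlobalSolution

variable {p u du v dv : ℝ → ℂ}

/-- Existence of solutions of the initial value problem. -/
theorem exists_of_initial (hp : ∀ a b, IntervalIntegrable p volume a b)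
    (hp0 : ∀ x ≤ 0, p x = 0) (α β : ℂ) :
    ∃ u du : ℝ → ℂ, IsGlobalSolution p u du ∧ u 0 = α ∧ du 0 = β := by
  obtain ⟨F, hFc, hF⟩ := exists_volterra_solution (f := fun x : ℝ => α + β * x) hp (by fun_prop)
  -- `F` is controlled only on [0, ∞), but p vanishes to the left of 0. For the same reason u is
  -- defined below as a double primitive, which is differentiable on the whole line.
  have h0 : ∀ x, IntervalIntegrable (fun t => p t * F t) volume 0 x := by
    intro x
    rcases le_total 0 x with hx | hx
    · exact (hp 0 x).mul_continuousOn (by rw [uIcc_of_le hx]; exact hFc x)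
    · refine (intervalIntegrable_const (c := (0 : ℂ))).congr fun t ht => ?_
      rw [uIoc_of_ge hx] at ht
      simp [hp0 t ht.2]
  have hint : ∀ a b, IntervalIntegrable (fun t => p t * F t) volume a b := fun a b =>
    (h0 a).symm.trans (h0 b)
  have hc : Continuous fun x => β + ∫ t in (0 : ℝ)..x, p t * F t :=
    continuous_const.add (intervalIntegral.continuous_primitive hint 0)
  set du : ℝ → ℂ := fun x => β + ∫ t in (0 : ℝ)..x, p t * F t with hdu
  set u : ℝ → ℂ := fun x => α + ∫ t in (0 : ℝ)..x, du t with hu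
  have huF : ∀ x, 0 ≤ x → u x = F x := by
    intro x hx
    rw [hF x hx, hu]
    simp only [hdu]
    rw [intervalIntegral.integral_add intervalIntegrable_const
      ((intervalIntegral.continuous_primitive hint 0).intervalIntegrable _ _)]
    simp
    ring
  have hpu : ∀ t, p t * F t = p t * u t := by
    intro t
    rcases le_total 0 t with ht | ht
    · rw [huF t ht]
    · simp [hp0 t ht]
  refine ⟨u, du, ⟨fun x => ?_, fun x => ?_⟩, by simp [hu], by simp [hdu]⟩
  · exact (intervalIntegral.integral_hasDerivAt_right (hc.intervalIntegrable _ _)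
      hc.stronglyMeasurable.stronglyMeasurableAtFilter hc.continuousAt).const_add α
  · simp [hdu, hpu]

/-- A solution that vanishes at a point together with its derivative vanishes identically. -/
theorem eq_zero_of_eq_zero (hp : ∀ a b, IntervalIntegrable p volume a b)
    (hp0 : ∀ x ≤ 0, p x = 0) (h : IsGlobalSolution p u du) {x₀ : ℝ} (hu : u x₀ = 0)
    (hdu : du x₀ = 0) (x : ℝ) : u x = 0 := by
  obtain ⟨θ, dθ, hθ, hθ0, hdθ0⟩ := exists_of_initial hp hp0 1 0
  obtain ⟨φ, dφ, hφ, hφ0, hdφ0⟩ := exists_of_initial hp hp0 0 1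
  have h1 := h.wronskian_eq hp hθ x₀ x
  have h2 := h.wronskian_eq hp hφ x₀ x
  have h3 := hθ.wronskian_eq hp hφ 0 x
  simp only [hθ0, hdθ0, hφ0, hdφ0, hu, hdu] at h1 h2 h3
  -- Writing W(f, g) = f g' - f' g, one has u W(θ, φ) = θ W(u, φ) - φ W(u, θ), where W(θ, φ) = 1 and
  -- the other two Wronskians vanish at x₀.
  linear_combination (-u x) * h3 + θ x * h2 - φ x * h1

end IsGlobalSolution

/-! ### Extension of solutions beyond [0, b). -/

/-- The coefficient `q - z` of the equation `u'' = (q - z) u`, cut off outside of `(0, b)`. -/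
noncomputable def cutoffPotential (q : ℝ → ℝ) (b : EReal) (z : ℂ) : ℝ → ℂ :=
  indicator {x : ℝ | 0 < x ∧ (x : EReal) < b} fun x => (q x : ℂ) - z

section Cutoff

variable {q : ℝ → ℝ} {b : EReal} {z : ℂ} {u du : ℝ → ℂ}

theorem cutoffPotential_of_mem {x : ℝ} (hx : 0 < x) (hxb : (x : EReal) < b) :
    cutoffPotential q b z x = (q x : ℂ) - z :=
  indicator_of_mem (s := {x : ℝ | 0 < x ∧ (x : EReal) < b}) ⟨hx, hxb⟩ _

theorem cutoffPotential_of_nonpos (x : ℝ) (hx : x ≤ 0) : cutoffPotential q b z x = 0 :=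
  indicator_of_notMem (fun h => hx.not_gt h.1) _

theorem intervalIntegrable_cutoffPotential
    (hq : ∀ c : ℝ, (c : EReal) ≤ b → IntegrableOn q (Ioo 0 c)) (x y : ℝ) :
    IntervalIntegrable (cutoffPotential q b z) volume x y := by
  have hS : MeasurableSet {x : ℝ | 0 < x ∧ (x : EReal) < b} :=
    measurableSet_Ioi.inter (measurable_coe_real_ereal measurableSet_Iio)
  suffices h : ∀ x y : ℝ, IntegrableOn (cutoffPotential q b z) (Ioc x y) from ⟨h x y, h y x⟩
  intro x y
  -- The alternative `c ≤ 0` serves only `b = ⊥`, where the set is empty.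
  obtain ⟨c, hcb, hc⟩ : ∃ c : ℝ, ((c : EReal) ≤ b ∨ c ≤ 0) ∧
      {x : ℝ | 0 < x ∧ (x : EReal) < b} ∩ Ioc x y ⊆ Ioo 0 c := by
    induction b with
    | bot => exact ⟨0, Or.inr le_rfl, fun t ht => absurd ht.1.2 not_lt_bot⟩
    | coe b => exact ⟨b, Or.inl le_rfl, fun t ht => ⟨ht.1.1, EReal.coe_lt_coe_iff.1 ht.1.2⟩⟩
    | top => exact ⟨y + 1, Or.inl le_top, fun t ht => ⟨ht.1.1, by linarith [ht.2.2]⟩⟩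
  have hqc : IntegrableOn q (Ioo 0 c) := by
    rcases hcb with h | h
    · exact hq c h
    · simp [Ioo_eq_empty (not_lt.2 h)]
  have h1 : IntegrableOn (fun x => (q x : ℂ) - z) (Ioo 0 c) :=
    (Integrable.ofReal hqc).sub (integrableOn_const (by simp))
  rw [IntegrableOn, cutoffPotential, integrable_indicator_iff hS, IntegrableOn,
    Measure.restrict_restrict hS]
  exact h1.mono_set hc

/-- The upper limit may equal b, where the cutoff changes the integrand, because a single point is a
null set. -/
theorem integral_cutoffPotential_mul (f : ℝ → ℂ) {x y : ℝ} (hx : 0 ≤ x) (hxy : x ≤ y)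
    (hyb : (y : EReal) ≤ b) :
    ∫ t in x..y, cutoffPotential q b z t * f t = ∫ t in x..y, ((q t : ℂ) - z) * f t := by
  refine intervalIntegral.integral_congr_ae ?_
  filter_upwards [compl_mem_ae_iff.2 (measure_singleton (μ := volume) y)] with t ht hty
  rw [uIoc_of_le hxy] at hty
  have hlt : t < y := lt_of_le_of_ne hty.2 ht
  rw [cutoffPotential_of_mem (hx.trans_lt hty.1) ((EReal.coe_lt_coe_iff.2 hlt).trans_le hyb)]

theorem IsGlobalSolution.isSchrodingerSolution
    (h : IsGlobalSolution (cutoffPotential q b z) u du) : IsSchrodingerSolution q b z u du := by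
  refine ⟨fun x _ _ => (h.hasDerivAt x).hasDerivWithinAt, fun x hx hxb => ?_⟩
  rw [h.equation x, integral_cutoffPotential_mul u le_rfl hx hxb.le]

/-- A solution on `[0, b)` is the restriction of a solution for the cut off potential. -/
theorem IsSchrodingerSolution.exists_global
    (hq : ∀ c : ℝ, (c : EReal) ≤ b → IntegrableOn q (Ioo 0 c))
    (h : IsSchrodingerSolution q b z u du) :
    ∃ U dU : ℝ → ℂ, IsGlobalSolution (cutoffPotential q b z) U dU ∧
      ∀ x : ℝ, 0 ≤ x → (x : EReal) < b → u x = U x ∧ du x = dU x := by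
  set p := cutoffPotential q b z with hpdef
  have hp : ∀ x y, IntervalIntegrable p volume x y := intervalIntegrable_cutoffPotential hq
  obtain ⟨U, dU, hU, hU0, hdU0⟩ :=
    IsGlobalSolution.exists_of_initial hp cutoffPotential_of_nonpos (u 0) (du 0)
  refine ⟨U, dU, hU, ?_⟩
  intro c hc hcb
  have hlt : ∀ {x : ℝ}, x ≤ c → (x : EReal) < b := fun hx =>
    (EReal.coe_le_coe_iff.2 hx).trans_lt hcb
  have huc : ContinuousOn u (Icc 0 c) := fun x hx =>
    ((h.hasDeriv x hx.1 (hlt hx.2)).continuousWithinAt).mono fun y hy => hy.1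
  have hpu : ∀ x ∈ Icc 0 c, IntervalIntegrable (fun t => p t * u t) volume 0 x := fun x hx =>
    (hp 0 x).mul_continuousOn (huc.mono (by rw [uIcc_of_le hx.1]; exact Icc_subset_Icc_right hx.2))
  have hdu : ∀ x ∈ Icc 0 c, du x = du 0 + ∫ t in (0 : ℝ)..x, p t * u t := fun x hx => by
    rw [h.equation x hx.1 (hlt hx.2), integral_cutoffPotential_mul u le_rfl hx.1 (hlt hx.2).le]
  have hd : ∀ x ∈ Icc 0 c, du x - dU x = ∫ t in (0 : ℝ)..x, p t * (u t - U t) := fun x hx => by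
    simp_rw [mul_sub]
    rw [intervalIntegral.integral_sub (hpu x hx) (hU.intervalIntegrable hp 0 x), hdu x hx,
      hU.equation x, hdU0]
    ring
  have hduc : ContinuousOn du (Icc 0 c) := by
    have : ContinuousOn (fun x => du 0 + ∫ t in (0 : ℝ)..x, p t * u t) (Icc 0 c) := by
      have := intervalIntegral.continuousOn_primitive_interval
        (f := fun t => p t * u t) (μ := volume) (a := 0) (b := c) (by
          rw [uIcc_of_le hc]
          exact (intervalIntegrable_iff_integrableOn_Icc_of_le hc).1 (hpu c ⟨hc, le_rfl⟩))
      rw [uIcc_of_le hc] at this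
      exact continuousOn_const.add this
    exact this.congr hdu
  have hcont : ContinuousOn (fun t => u t - U t) (Icc 0 c) := huc.sub hU.continuous.continuousOn
  -- The difference u - U has zero initial data, hence solves the homogeneous Volterra equation.
  have hzero := eq_zero_of_volterra (c := c) hp hcont (by
    intro x hx
    have hsub : Icc 0 x ⊆ Icc 0 c := Icc_subset_Icc_right hx.2
    have h1 : ∫ s in (0 : ℝ)..x, (du s - dU s) = (u x - U x) - (u 0 - U 0) := by
      refine intervalIntegral.integral_eq_sub_of_hasDerivAt_of_le hx.1 (hcont.mono hsub)
        (fun t ht => ?_) ?_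
      · exact ((h.hasDeriv t ht.1.le (hlt (ht.2.le.trans hx.2))).hasDerivAt
          (Ici_mem_nhds ht.1)).sub (hU.hasDerivAt t)
      · refine ContinuousOn.intervalIntegrable ?_
        rw [uIcc_of_le hx.1]
        exact ((hduc.mono hsub).sub (hU.continuous_deriv hp).continuousOn)
    rw [hU0, sub_self, sub_zero] at h1
    rw [← h1]
    refine intervalIntegral.integral_congr fun s hs => ?_
    rw [uIcc_of_le hx.1] at hs
    exact hd s (hsub hs))
  refine ⟨sub_eq_zero.1 (hzero c ⟨hc, le_rfl⟩), sub_eq_zero.1 ?_⟩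
  rw [hd c ⟨hc, le_rfl⟩, intervalIntegral.integral_congr (g := fun _ => 0), intervalIntegral.integral_zero]
  intro s hs
  rw [uIcc_of_le hc] at hs
  simp only [hzero s hs, mul_zero]

/-- The imaginary part of `ū u'` decreases with rate `Im z |u|²`. -/
theorem IsGlobalSolution.im_conj_mul_deriv
    (hq : ∀ c : ℝ, (c : EReal) ≤ b → IntegrableOn q (Ioo 0 c))
    (h : IsGlobalSolution (cutoffPotential q b z) u du) {x y : ℝ} (hx : 0 ≤ x) (hxy : x ≤ y)
    (hyb : (y : EReal) ≤ b) :
    (star (u x) * du x).im = (star (u y) * du y).im + z.im * ∫ t in x..y, ‖u t‖ ^ 2 := by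
  have hp : ∀ x y, IntervalIntegrable (cutoffPotential q b z) volume x y :=
    intervalIntegrable_cutoffPotential hq
  have hp' : ∀ x y, IntervalIntegrable (fun t => star (cutoffPotential q b z t)) volume x y :=
    fun x y => ⟨Complex.conjCLE.toContinuousLinearMap.integrable_comp (hp x y).1,
      Complex.conjCLE.toContinuousLinearMap.integrable_comp (hp x y).2⟩
  -- Lagrange's identity for ū and u; the coefficients differ by -2i Im z, as q is real.
  have h1 := (h.conj hp).wronskian_sub hp' hp h x y
  have h2 : ∫ t in x..y, (cutoffPotential q b z t - star (cutoffPotential q b z t)) *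
      (star (u t) * u t) = ∫ t in x..y, (-2 * Complex.I * z.im) * ((‖u t‖ ^ 2 : ℝ) : ℂ) := by
    refine intervalIntegral.integral_congr_ae ?_
    filter_upwards [compl_mem_ae_iff.2 (measure_singleton (μ := volume) y)] with t ht hty
    rw [uIoc_of_le hxy] at hty
    have hlt : t < y := lt_of_le_of_ne hty.2 ht
    rw [cutoffPotential_of_mem (hx.trans_lt hty.1) ((EReal.coe_lt_coe_iff.2 hlt).trans_le hyb)]
    rw [show star (u t) * u t = ((‖u t‖ ^ 2 : ℝ) : ℂ) from by
      rw [Complex.star_def, Complex.conj_mul']; push_cast; rfl]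
    congr 1
    apply Complex.ext <;> simp
    ring
  rw [h2, intervalIntegral.integral_const_mul, intervalIntegral.integral_ofReal] at h1
  have h3 := congrArg Complex.im h1
  simp at h3 ⊢
  linarith

end Cutoff

/-! ### The two estimates for u'/u, for bounded and for large |κ|. -/

section Estimates

variable {p u du : ℝ → ℂ}

/-- If `Im (ū u')` dominates the mass of `|u|²` on a short interval to the right of `x`, then `u'(x)`
is controlled by `u(x)`. -/
theorem IsGlobalSolution.norm_deriv_le (hp : ∀ a b, IntervalIntegrable p volume a b)
    (h : IsGlobalSolution p u du) {x s N θ : ℝ} (hs : 0 < s)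
    (hN : ∫ t in x..(x + s), ‖p t‖ ≤ N) (hNs : N * s ≤ 1 / 4) (hθ : 0 < θ)
    (hW : θ * ∫ t in x..(x + s), ‖u t‖ ^ 2 ≤ (star (u x) * du x).im) :
    ‖du x‖ ≤ (12 / s + 72 / (θ * s ^ 3)) * ‖u x‖ := by
  set A := ‖u x‖ with hA
  set D := ‖du x‖ with hD
  have hA0 : 0 ≤ A := norm_nonneg _
  have hD0 : 0 ≤ D := norm_nonneg _
  have hxs : x ≤ x + s := by linarith
  have hduc := h.continuous_deriv hp
  have hN0 : 0 ≤ N := (intervalIntegral.integral_nonneg hxs fun _ _ => norm_nonneg _).trans hN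
  obtain ⟨t₀, ht₀, hmax⟩ := isCompact_Icc.exists_isMaxOn (nonempty_Icc.2 hxs)
    hduc.norm.continuousOn
  set S := ‖du t₀‖ with hS
  have hS0 : 0 ≤ S := norm_nonneg _
  have hSb : ∀ t ∈ Icc x (x + s), ‖du t‖ ≤ S := fun t ht => hmax ht
  have hxm : x ∈ Icc x (x + s) := ⟨le_rfl, hxs⟩
  have hub : ∀ t ∈ Icc x (x + s), ‖u t‖ ≤ A + s * S := by
    intro t ht
    have h1 := (convex_Icc x (x + s)).norm_image_sub_le_of_norm_hasDerivWithin_le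
      (fun y _ => (h.hasDerivAt y).hasDerivWithinAt) hSb hxm ht
    rw [Real.norm_eq_abs, abs_of_nonneg (by linarith [ht.1])] at h1
    have h2 : ‖u t‖ ≤ ‖u x‖ + ‖u t - u x‖ := by
      simpa using norm_add_le (u x) (u t - u x)
    nlinarith [ht.2]
  have hdiff : ∀ t ∈ Icc x (x + s), ‖du t - du x‖ ≤ N * (A + s * S) := by
    intro t ht
    have h0 : 0 ≤ A + s * S := by positivity
    rw [h.deriv_eq hp x t, add_sub_cancel_left]
    calc ‖∫ y in x..t, p y * u y‖ ≤ ∫ y in x..t, ‖p y‖ * (A + s * S) := by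
          refine intervalIntegral.norm_integral_le_of_norm_le ht.1
            (Eventually.of_forall fun y hy => ?_) ((hp x t).norm.mul_const _)
          rw [norm_mul]
          exact mul_le_mul_of_nonneg_left (hub y ⟨hy.1.le, hy.2.trans ht.2⟩) (norm_nonneg _)
      _ = (∫ y in x..t, ‖p y‖) * (A + s * S) := intervalIntegral.integral_mul_const _ _
      _ ≤ N * (A + s * S) := by
          refine mul_le_mul_of_nonneg_right (le_trans ?_ hN) h0
          exact intervalIntegral.integral_mono_interval le_rfl ht.1 ht.2
            (Eventually.of_forall fun _ => norm_nonneg _) (hp _ _).norm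
  -- Since N s ≤ 1/4, the term with S on the right can be absorbed, so that S ≤ 4/3 (D + N A).
  have hSle : S ≤ D + N * (A + s * S) := by
    have := hdiff t₀ ht₀
    have h2 : ‖du t₀‖ ≤ ‖du x‖ + ‖du t₀ - du x‖ := by
      simpa using norm_add_le (du x) (du t₀ - du x)
    linarith
  have hNS : N * s * S ≤ 1 / 4 * S := mul_le_mul_of_nonneg_right hNs hS0
  have hNA : s * (N * A) ≤ 1 / 4 * A := by
    have := mul_le_mul_of_nonneg_right hNs hA0
    linarith
  have hdiff' : ∀ t ∈ Icc x (x + s), ‖du t - du x‖ ≤ D / 3 + 4 / 3 * (N * A) := fun t ht => by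
    have := hdiff t ht
    linarith
  -- On the right half of the interval u stays close to its tangent at x, whose slope has modulus D.
  have hlow : ∀ t ∈ Icc (x + s / 2) (x + s), s / 3 * D - 4 / 3 * A ≤ ‖u t‖ := by
    intro t ht
    have htm : t ∈ Icc x (x + s) := ⟨by linarith [ht.1], ht.2⟩
    have h1 := (convex_Icc x (x + s)).norm_image_sub_le_of_norm_hasDerivWithin_le
      (f := fun y : ℝ => u y - (y - x : ℝ) * du x) (f' := fun y => du y - du x)
      (fun y _ => by
        have h2 : HasDerivAt (fun y : ℝ => ((y - x : ℝ) : ℂ)) 1 y :=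
          ((hasDerivAt_id y).sub_const x).ofReal_comp
        simpa using ((h.hasDerivAt y).fun_sub (h2.mul_const (du x))).hasDerivWithinAt)
      hdiff' hxm htm
    rw [Real.norm_eq_abs, abs_of_nonneg (by linarith [htm.1])] at h1
    simp only [sub_self, Complex.ofReal_zero, zero_mul, sub_zero] at h1
    have h3 : ‖((t - x : ℝ) : ℂ) * du x‖ = (t - x) * D := by
      rw [norm_mul, Complex.norm_real, Real.norm_eq_abs, abs_of_nonneg (by linarith [htm.1])]
    have h4 : ‖((t - x : ℝ) : ℂ) * du x‖ ≤ ‖u t‖ + A + ‖u t - ((t - x : ℝ) : ℂ) * du x - u x‖ := by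
      calc ‖((t - x : ℝ) : ℂ) * du x‖
          = ‖u t - u x - (u t - ((t - x : ℝ) : ℂ) * du x - u x)‖ := by congr 1; ring
        _ ≤ ‖u t - u x‖ + _ := norm_sub_le _ _
        _ ≤ _ := by gcongr; exact norm_sub_le _ _
    rw [h3] at h4
    have h5 : s / 2 ≤ t - x := by linarith [ht.1]
    have h6 : t - x ≤ s := by linarith [ht.2]
    have h7 : (t - x) * (N * A) ≤ s * (N * A) :=
      mul_le_mul_of_nonneg_right h6 (by positivity)
    have h8 : s / 2 * D ≤ (t - x) * D := mul_le_mul_of_nonneg_right h5 hD0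
    nlinarith
  rw [add_mul]
  -- If D exceeds 12A/s, the lower bound `hlow` is at least s D/6, and the mass of |u|² is at least
  -- s³D²/72.
  rcases le_total D (12 / s * A) with hcase | hcase
  · have : 0 ≤ 72 / (θ * s ^ 3) * A := by positivity
    linarith
  have hcase' : 12 * A ≤ s * D := by
    rw [div_mul_eq_mul_div, div_le_iff₀ hs] at hcase
    linarith
  have huc := h.continuous
  have hint : ∀ a b, IntervalIntegrable (fun t => ‖u t‖ ^ 2) volume a b := fun a b =>
    (huc.norm.pow 2).intervalIntegrable a b
  have hmass : s / 2 * (s * D / 6) ^ 2 ≤ ∫ t in x..(x + s), ‖u t‖ ^ 2 := by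
    calc s / 2 * (s * D / 6) ^ 2 = ∫ t in (x + s / 2)..(x + s), (s * D / 6) ^ 2 := by
          rw [intervalIntegral.integral_const, smul_eq_mul]; ring
      _ ≤ ∫ t in (x + s / 2)..(x + s), ‖u t‖ ^ 2 := by
          refine intervalIntegral.integral_mono_on (by linarith) intervalIntegrable_const
            (hint _ _) fun t ht => ?_
          have := hlow t ht
          exact pow_le_pow_left₀ (by positivity) (by linarith) 2
      _ ≤ ∫ t in x..(x + s), ‖u t‖ ^ 2 :=
          intervalIntegral.integral_mono_interval (by linarith) (by linarith) le_rfl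
            (Eventually.of_forall fun _ => by positivity) (hint _ _)
  have hAD : (star (u x) * du x).im ≤ A * D := by
    refine (Complex.abs_im_le_norm _).trans' (le_abs_self _) |>.trans_eq ?_
    rw [norm_mul, norm_star]
  have hfin : θ * (s / 2 * (s * D / 6) ^ 2) ≤ A * D :=
    (mul_le_mul_of_nonneg_left hmass hθ.le).trans (hW.trans hAD)
  have : 0 ≤ 12 / s * A := by positivity
  suffices D ≤ 72 / (θ * s ^ 3) * A by linarith
  rcases hD0.eq_or_lt with hD1 | hD1
  · rw [← hD1]; positivity
  rw [div_mul_eq_mul_div, le_div_iff₀ (by positivity)]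
  refine le_of_mul_le_mul_right ?_ hD1
  nlinarith

/-- `|u' - κ u|` dominates `|κ u|` if `Im (ū u') ≥ 0` and `κ` is well inside the lower half-plane. -/
theorem mul_norm_le_norm_sub {a c κ : ℂ} {σ : ℝ} (hκ : σ * ‖κ‖ ≤ -κ.im)
    (hW : 0 ≤ (star a * c).im) : σ * ‖κ‖ * ‖a‖ ≤ ‖c - κ * a‖ := by
  rcases eq_or_ne a 0 with rfl | ha
  · simp
  have ha' : 0 < ‖a‖ := norm_pos_iff.2 ha
  refine le_of_mul_le_mul_right ?_ ha'
  -- Both terms on the right are nonnegative, and the second is at least σ|κ| |a|².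
  have h1 : (star a * (c - κ * a)).im = (star a * c).im - κ.im * ‖a‖ ^ 2 := by
    rw [mul_sub, Complex.sub_im, show star a * (κ * a) = κ * ((‖a‖ ^ 2 : ℝ) : ℂ) from by
      rw [mul_left_comm, Complex.star_def, Complex.conj_mul']; push_cast; rfl, Complex.im_mul_ofReal]
  have h2 : (star a * (c - κ * a)).im ≤ ‖c - κ * a‖ * ‖a‖ := by
    refine (Complex.abs_im_le_norm _).trans' (le_abs_self _) |>.trans_eq ?_
    rw [norm_mul, norm_star, mul_comm]
  have h3 := mul_le_mul_of_nonneg_right hκ (sq_nonneg ‖a‖)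
  nlinarith

/-- The Cayley-type transform `(m + κ) / (m - κ)` of the logarithmic derivative is `O(1 / |κ|)`. -/
theorem IsGlobalSolution.norm_add_le_mul_norm_sub {q : ℝ → ℝ} {b : EReal} {κ : ℂ}
    (hq : ∀ c : ℝ, (c : EReal) ≤ b → IntegrableOn q (Ioo 0 c))
    (h : IsGlobalSolution (cutoffPotential q b (-κ ^ 2)) u du)
    {x δ σ η : ℝ} (hx : 0 ≤ x) (hδ : 0 < δ) (hxb : ((x + δ : ℝ) : EReal) ≤ b)
    (hσ : 0 < σ) (hκ0 : 0 < ‖κ‖) (hre : σ * ‖κ‖ ≤ κ.re) (him : σ * ‖κ‖ ≤ -κ.im)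
    (hW : ∀ t ∈ Icc x (x + δ), 0 ≤ (star (u t) * du t).im)
    (hne : ∀ t, u t = 0 → du t ≠ 0) (hη : ∫ t in x..(x + δ), |q t| ≤ η) :
    ‖du x + κ * u x‖ ≤
      ((1 + 2 / σ) / (2 * σ * δ) + 2 * η / σ ^ 2) / ‖κ‖ * ‖du x - κ * u x‖ := by
  set p := cutoffPotential q b (-κ ^ 2) with hpdef
  have hp : ∀ x y, IntervalIntegrable p volume x y := intervalIntegrable_cutoffPotential hq
  have hxd : x ≤ x + δ := by linarith
  have hwu : ∀ t ∈ Icc x (x + δ), σ * ‖κ‖ * ‖u t‖ ≤ ‖du t - κ * u t‖ := fun t ht =>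
    mul_norm_le_norm_sub him (hW t ht)
  have hw0 : ∀ t ∈ Icc x (x + δ), du t - κ * u t ≠ 0 := by
    intro t ht h0
    have h1 := hwu t ht
    rw [h0, norm_zero] at h1
    have h2 : u t = 0 := by
      rw [← norm_le_zero_iff]
      exact nonpos_of_mul_nonpos_right h1 (by positivity)
    refine hne t h2 ?_
    simpa [h2] using h0
  have hv : ∀ t ∈ Icc x (x + δ), ‖du t + κ * u t‖ ≤ (1 + 2 / σ) * ‖du t - κ * u t‖ := by
    intro t ht
    have h1 : ‖du t + κ * u t‖ ≤ ‖du t - κ * u t‖ + 2 * (‖κ‖ * ‖u t‖) := by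
      calc ‖du t + κ * u t‖ = ‖(du t - κ * u t) + 2 * (κ * u t)‖ := by congr 1; ring
        _ ≤ _ := (norm_add_le _ _).trans_eq (by simp)
    have h2 : ‖κ‖ * ‖u t‖ ≤ ‖du t - κ * u t‖ / σ := by
      rw [le_div_iff₀ hσ]; linarith [hwu t ht]
    calc _ ≤ _ := h1
      _ ≤ ‖du t - κ * u t‖ + 2 * (‖du t - κ * u t‖ / σ) := by gcongr
      _ = _ := by ring
  have hAu := h.hasACDeriv hp x (x + δ)
  have hAdu := h.hasACDeriv_deriv hp x (x + δ)
  have hAw : HasACDeriv (fun t => du t - κ * u t) (fun t => p t * u t - κ * du t) x (x + δ) := by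
    simpa [sub_eq_add_neg] using hAdu.add (hAu.const_mul (-κ))
  have hAv : HasACDeriv (fun t => du t + κ * u t) (fun t => p t * u t + κ * du t) x (x + δ) :=
    hAdu.add (hAu.const_mul κ)
  have hAe : HasACDeriv (fun t : ℝ => Complex.exp (-2 * κ * ((t - x : ℝ) : ℂ)))
      (fun t : ℝ => Complex.exp (-2 * κ * ((t - x : ℝ) : ℂ)) * (-2 * κ)) x (x + δ) := by
    refine .of_hasDerivAt (fun t => ?_) (by fun_prop)
    have h2 : HasDerivAt (fun y : ℝ => ((y - x : ℝ) : ℂ)) 1 t :=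
      ((hasDerivAt_id t).sub_const x).ofReal_comp
    simpa using (h2.const_mul (-2 * κ)).cexp
  rw [← uIcc_of_le hxd] at hw0
  have hAG := hAe.mul (hAv.mul (hAw.inv hw0))
  -- For ρ = (u' + κu)/(u' - κu) the derivative of exp(-2κ(t - x)) ρ contains no ρ any more, only p
  -- - κ², which is q on (0, b).
  have hI := (hAG.congr_deriv (g := fun t : ℝ => -2 * κ * Complex.exp (-2 * κ * ((t - x : ℝ) : ℂ)) *
      (p t - κ ^ 2) * (u t / (du t - κ * u t)) ^ 2) fun t ht => by
    have := hw0 t ht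
    field_simp
    ring).integral_eq
  rw [uIcc_of_le hxd] at hw0
  simp only [sub_self, Complex.ofReal_zero, mul_zero, Complex.exp_zero, one_mul, add_sub_cancel_left]
    at hI
  have hexp : ∀ t : ℝ, ‖Complex.exp (-2 * κ * (t : ℂ))‖ = Real.exp (-(2 * κ.re * t)) := by
    intro t
    rw [Complex.norm_exp]
    congr 1
    simp
  have hre0 : 0 < κ.re := (mul_pos hσ hκ0).trans_le hre
  have hqi : IntervalIntegrable (fun t => |q t|) volume x (x + δ) := by
    rw [intervalIntegrable_iff_integrableOn_Ioo_of_le hxd]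
    exact ((hq _ hxb).mono_set (Ioo_subset_Ioo_left hx)).abs
  have hIle : ‖∫ t in x..(x + δ), -2 * κ * Complex.exp (-2 * κ * ((t - x : ℝ) : ℂ)) *
      (p t - κ ^ 2) * (u t / (du t - κ * u t)) ^ 2‖ ≤ 2 * η / σ ^ 2 / ‖κ‖ := by
    calc _ ≤ ∫ t in x..(x + δ), 2 / (σ ^ 2 * ‖κ‖) * |q t| := by
          refine intervalIntegral.norm_integral_le_of_norm_le hxd ?_ (hqi.const_mul _)
          filter_upwards [compl_mem_ae_iff.2 (measure_singleton (μ := volume) (x + δ))]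
            with t ht hty
          have hlt : t < x + δ := lt_of_le_of_ne hty.2 ht
          have htm : t ∈ Icc x (x + δ) := ⟨hty.1.le, hty.2⟩
          have h1 : p t - κ ^ 2 = (q t : ℂ) := by
            rw [hpdef, cutoffPotential_of_mem (hx.trans_lt hty.1)
              ((EReal.coe_lt_coe_iff.2 hlt).trans_le hxb)]
            ring
          have h2 : ‖u t / (du t - κ * u t)‖ ≤ 1 / (σ * ‖κ‖) := by
            rw [norm_div, div_le_div_iff₀ (norm_pos_iff.2 (hw0 t htm)) (by positivity)]
            linarith [hwu t htm]
          have h3 : ‖Complex.exp (-2 * κ * ((t - x : ℝ) : ℂ))‖ ≤ 1 := by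
            rw [hexp, Real.exp_le_one_iff]
            have : 0 ≤ t - x := by linarith [hty.1]
            have : 0 ≤ 2 * κ.re * (t - x) := by positivity
            linarith
          rw [h1, norm_mul, norm_mul, norm_mul, norm_mul, norm_pow, Complex.norm_real, norm_neg,
            Real.norm_eq_abs, Complex.norm_two]
          calc 2 * ‖κ‖ * ‖Complex.exp (-2 * κ * ((t - x : ℝ) : ℂ))‖ * |q t| *
                ‖u t / (du t - κ * u t)‖ ^ 2
              ≤ 2 * ‖κ‖ * 1 * |q t| * (1 / (σ * ‖κ‖)) ^ 2 := by gcongr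
            _ = 2 / (σ ^ 2 * ‖κ‖) * |q t| := by field_simp
      _ = 2 / (σ ^ 2 * ‖κ‖) * ∫ t in x..(x + δ), |q t| := intervalIntegral.integral_const_mul _ _
      _ ≤ 2 / (σ ^ 2 * ‖κ‖) * η := by gcongr
      _ = _ := by field_simp
  have hend : ‖Complex.exp (-2 * κ * (δ : ℂ)) * ((du (x + δ) + κ * u (x + δ)) *
      (du (x + δ) - κ * u (x + δ))⁻¹)‖ ≤ (1 + 2 / σ) / (2 * σ * δ) / ‖κ‖ := by
    have hm : x + δ ∈ Icc x (x + δ) := ⟨hxd, le_rfl⟩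
    rw [norm_mul, hexp, norm_mul, norm_inv, ← div_eq_mul_inv]
    have h1 : ‖du (x + δ) + κ * u (x + δ)‖ / ‖du (x + δ) - κ * u (x + δ)‖ ≤ 1 + 2 / σ := by
      rw [div_le_iff₀ (norm_pos_iff.2 (hw0 _ hm))]
      exact hv _ hm
    -- The crude bound exp(-y) ≤ 1/y suffices, as only the order 1/|κ| is needed.
    have h2 : Real.exp (-(2 * κ.re * δ)) ≤ 1 / (2 * σ * δ * ‖κ‖) := by
      rw [Real.exp_neg, ← one_div]
      refine one_div_le_one_div_of_le (by positivity) ?_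
      have h3 := Real.add_one_le_exp (2 * κ.re * δ)
      have h4 := mul_le_mul_of_nonneg_right hre hδ.le
      linarith
    calc _ ≤ 1 / (2 * σ * δ * ‖κ‖) * (1 + 2 / σ) := by gcongr
      _ = _ := by field_simp
  have hxm : x ∈ Icc x (x + δ) := ⟨le_rfl, hxd⟩
  have hρ : ‖(du x + κ * u x) * (du x - κ * u x)⁻¹‖ ≤
      ((1 + 2 / σ) / (2 * σ * δ) + 2 * η / σ ^ 2) / ‖κ‖ := by
    rw [add_div]
    refine le_trans (le_of_eq_of_le ?_ (norm_sub_le _ _)) (add_le_add hend hIle)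
    rw [hI]
    congr 1
    ring
  rw [norm_mul, norm_inv, ← div_eq_mul_inv, div_le_iff₀ (norm_pos_iff.2 (hw0 x hxm))] at hρ
  exact hρ

end Estimates

/-! ### The sign of Im(ū u') under each boundary condition. -/

section Positivity

variable {q : ℝ → ℝ} {b : EReal} {z : ℂ} {u du v dv : ℝ → ℂ}

/-- If u vanished on an interval, u' would vanish inside it, and u would be zero by uniqueness. -/
theorem IsGlobalSolution.integral_norm_sq_pos {p : ℝ → ℂ}
    (hp : ∀ a b, IntervalIntegrable p volume a b) (hp0 : ∀ x ≤ 0, p x = 0)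
    (h : IsGlobalSolution p u du) {x₀ : ℝ} (hne : u x₀ ≠ 0) {x y : ℝ} (hxy : x < y) :
    0 < ∫ t in x..y, ‖u t‖ ^ 2 := by
  refine intervalIntegral.integral_pos hxy (h.continuous.norm.pow 2).continuousOn
    (fun _ _ => by positivity) ?_
  by_contra! hcon
  have hzero : ∀ t ∈ Icc x y, u t = 0 := fun t ht =>
    norm_eq_zero.1 (pow_eq_zero_iff two_ne_zero |>.1 (le_antisymm (hcon t ht) (by positivity)))
  have hm : (x + y) / 2 ∈ Ioo x y := ⟨by linarith, by linarith⟩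
  refine hne (h.eq_zero_of_eq_zero hp hp0 (hzero _ (Ioo_subset_Icc_self hm)) ?_ x₀)
  have hev : u =ᶠ[𝓝 ((x + y) / 2)] fun _ => 0 := by
    filter_upwards [Ioo_mem_nhds hm.1 hm.2] with t ht using hzero t (Ioo_subset_Icc_self ht)
  exact (h.hasDerivAt _).unique ((hasDerivAt_const _ _).congr_of_eventuallyEq hev)

theorem IsGlobalSolution.im_conj_mul_deriv_anti
    (hq : ∀ c : ℝ, (c : EReal) ≤ b → IntegrableOn q (Ioo 0 c)) (hz : 0 < z.im)
    (h : IsGlobalSolution (cutoffPotential q b z) u du) {x y : ℝ} (hx : 0 ≤ x) (hxy : x ≤ y)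
    (hyb : (y : EReal) ≤ b) : (star (u y) * du y).im ≤ (star (u x) * du x).im := by
  rw [h.im_conj_mul_deriv hq hx hxy hyb]
  have : 0 ≤ ∫ t in x..y, ‖u t‖ ^ 2 :=
    intervalIntegral.integral_nonneg hxy fun _ _ => by positivity
  have := mul_nonneg hz.le this
  linarith

/-- Existence of a square integrable solution `v` with `Im (v̄ v') ≥ 0`, as a limit of solutions that
vanish at a point tending to infinity. -/
theorem exists_weyl_solution (hq : ∀ c : ℝ, (c : EReal) ≤ ⊤ → IntegrableOn q (Ioo 0 c))
    (hz : 0 < z.im) :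
    ∃ v dv : ℝ → ℂ, IsGlobalSolution (cutoffPotential q ⊤ z) v dv ∧ v 0 = 1 ∧
      (∀ y, 0 ≤ y → 0 ≤ (star (v y) * dv y).im) ∧ IsSquareIntegrable v := by
  set p := cutoffPotential q ⊤ z with hpdef
  have hp : ∀ x y, IntervalIntegrable p volume x y := intervalIntegrable_cutoffPotential hq
  have hp0 : ∀ x ≤ 0, p x = 0 := cutoffPotential_of_nonpos
  obtain ⟨θ, dθ, hθ, hθ0, hdθ0⟩ := IsGlobalSolution.exists_of_initial hp hp0 1 0
  obtain ⟨φ, dφ, hφ, hφ0, hdφ0⟩ := IsGlobalSolution.exists_of_initial hp hp0 0 1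
  have hsol : ∀ m : ℂ, IsGlobalSolution p (fun t => θ t + m * φ t) (fun t => dθ t + m * dφ t) :=
    fun m => hθ.add hp (hφ.const_mul m)
  -- A zero of φ at y would make z a nonreal Dirichlet eigenvalue on [0, y]: Im(φ̄ φ') would vanish
  -- at both ends, forcing the mass of φ to be zero.
  have hφne : ∀ y, 0 < y → φ y ≠ 0 := by
    intro y hy hzero
    obtain ⟨x₀, hx₀⟩ : ∃ x₀, φ x₀ ≠ 0 := by
      by_contra! hall
      have : dφ 0 = 0 := (hφ.hasDerivAt 0).unique
        ((hasDerivAt_const 0 (0 : ℂ)).congr_of_eventuallyEq (Eventually.of_forall hall))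
      simp [hdφ0] at this
    have h1 := hφ.im_conj_mul_deriv hq le_rfl hy.le le_top
    have h2 := mul_pos hz (hφ.integral_norm_sq_pos hp hp0 hx₀ hy)
    rw [hφ0, hzero] at h1
    simp at h1
    rcases h1 with h1 | h1 <;> simp [h1] at h2
  -- With this coefficient θ + mφ vanishes at n + 1, a positive point also for n = 0.
  set m : ℕ → ℂ := fun n => -θ (n + 1 : ℕ) / φ (n + 1 : ℕ) with hm
  have hmW : ∀ n : ℕ, ∀ y : ℝ, 0 ≤ y → y ≤ (n + 1 : ℕ) →
      0 ≤ (star (θ y + m n * φ y) * (dθ y + m n * dφ y)).im := by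
    intro n y hy hyn
    have h1 := (hsol (m n)).im_conj_mul_deriv_anti hq hz hy hyn le_top
    have h2 : θ (n + 1 : ℕ) + m n * φ (n + 1 : ℕ) = 0 := by
      have := hφne (n + 1 : ℕ) (by positivity)
      rw [hm]
      field_simp
      ring
    simpa only [h2, star_zero, zero_mul, Complex.zero_im] using h1
  -- The solution θ + mφ has value 1 and derivative m at 0, so `norm_deriv_le` at 0 bounds m; its
  -- interval lies in [0, 1], uniformly in n.
  obtain ⟨C, hC⟩ : ∃ C : ℝ, ∀ n, ‖m n‖ ≤ C := by
    set N := ∫ t in (0 : ℝ)..1, ‖p t‖ with hN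
    have hN0 : 0 ≤ N := primitive_norm_nonneg zero_le_one
    set s : ℝ := 1 / (4 * (N + 1)) with hs
    have hs0 : 0 < s := by positivity
    have hs1 : s ≤ 1 := by rw [hs, div_le_one (by positivity)]; linarith
    have hNs : N * s ≤ 1 / 4 := by
      rw [hs, mul_one_div, div_le_div_iff₀ (by positivity) (by norm_num)]
      linarith
    refine ⟨12 / s + 72 / (z.im * s ^ 3), fun n => ?_⟩
    have h1 := (hsol (m n)).norm_deriv_le hp (x := 0) (θ := z.im) hs0
      (by rw [zero_add]; exact primitive_norm_mono hp hs0.le hs1) hNs hz (by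
        rw [(hsol (m n)).im_conj_mul_deriv hq le_rfl (by linarith : (0 : ℝ) ≤ 0 + s) le_top]
        have := hmW n (0 + s) (by linarith) (by
          have : (0 : ℝ) ≤ n := n.cast_nonneg
          push_cast
          linarith)
        linarith)
    simpa [hθ0, hφ0, hdθ0, hdφ0] using h1
  obtain ⟨m₀, -, ν, hν, hlim⟩ := tendsto_subseq_of_bounded (Metric.isBounded_closedBall (x := (0 : ℂ)) (r := C))
    (x := m) fun n => by simpa using hC n
  have hW : ∀ y, 0 ≤ y → 0 ≤ (star (θ y + m₀ * φ y) * (dθ y + m₀ * dφ y)).im := by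
    intro y hy
    have hcont : Continuous fun w : ℂ => (star (θ y + w * φ y) * (dθ y + w * dφ y)).im := by
      fun_prop
    refine ge_of_tendsto ((hcont.tendsto m₀).comp hlim) ?_
    obtain ⟨k, hk⟩ := exists_nat_ge y
    filter_upwards [eventually_ge_atTop k] with n hn
    refine hmW (ν n) y hy (hk.trans ?_)
    have : k ≤ ν n + 1 := (hn.trans (hν.id_le n)).trans (Nat.le_succ _)
    exact_mod_cast this
  refine ⟨_, _, hsol m₀, by simp [hθ0, hφ0], hW, ?_⟩
  -- Im z times the mass on [0, y] equals Im m₀ - Im(v̄ v')(y), which is at most Im m₀.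
  refine integrableOn_Ioi_of_intervalIntegral_norm_bounded (ι := ℝ) (l := atTop) (b := id)
    (m₀.im / z.im) 0 (fun y => ?_) tendsto_id ?_
  · exact ((hsol m₀).continuous.norm.pow 2).integrableOn_Ioc
  · filter_upwards [eventually_ge_atTop 0] with y hy
    have h1 := (hsol m₀).im_conj_mul_deriv hq le_rfl hy le_top
    have h2 := hW y hy
    simp only [hθ0, hφ0, hdθ0, hdφ0, mul_zero, mul_one, add_zero, zero_add, star_one, one_mul] at h1
    simp only [id, norm_pow, norm_norm]
    rw [le_div_iff₀ hz]
    linarith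

/-- The square integrable solutions form a line, so u is a multiple of the solution from
`exists_weyl_solution`, and Im(ū u') scales by the squared modulus of the factor. -/
theorem im_conj_mul_deriv_nonneg_of_limitPoint
    (hq : ∀ c : ℝ, (c : EReal) ≤ ⊤ → IntegrableOn q (Ioo 0 c)) (hlp : IsLimitPoint q)
    (hz : 0 < z.im) (h : IsGlobalSolution (cutoffPotential q ⊤ z) u du)
    (hu : IsSquareIntegrable u) {y : ℝ} (hy : 0 ≤ y) : 0 ≤ (star (u y) * du y).im := by
  obtain ⟨v, dv, hv, hv0, hvW, hvL⟩ := exists_weyl_solution hq hz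
  obtain ⟨w, dw, hw, -, -, huniq⟩ := hlp z hz
  obtain ⟨c, hc⟩ := huniq u du h.isSchrodingerSolution hu
  obtain ⟨c', hc'⟩ := huniq v dv hv.isSchrodingerSolution hvL
  have hne : c' * w 0 ≠ 0 := by rw [← hc' 0 le_rfl, hv0]; exact one_ne_zero
  have hc'0 : c' ≠ 0 := left_ne_zero_of_mul hne
  have huv : ∀ x, 0 ≤ x → u x = c / c' * v x := fun x hx => by
    rw [hc x hx, hc' x hx]
    field_simp
  have hduv : du y = c / c' * dv y := by
    have h1 : HasDerivWithinAt u (c / c' * dv y) (Ici 0) y :=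
      ((hv.hasDerivAt y).const_mul (c / c')).hasDerivWithinAt.congr (fun x hx => huv x hx) (huv y hy)
    exact (uniqueDiffOn_Ici (0 : ℝ) y hy).eq_deriv _ (h.hasDerivAt y).hasDerivWithinAt h1
  have : star (u y) * du y = (‖c / c'‖ ^ 2 : ℝ) * (star (v y) * dv y) := by
    rw [huv y hy, hduv, star_mul']
    push_cast
    rw [← Complex.conj_mul' (c / c'), ← Complex.star_def]
    ring
  rw [this, Complex.im_ofReal_mul]
  exact mul_nonneg (by positivity) (hvW y hy)

theorem star_cutoffPotential :
    (fun t => star (cutoffPotential q b z t)) = cutoffPotential q b (star z) := by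
  funext t
  by_cases ht : t ∈ {x : ℝ | 0 < x ∧ (x : EReal) < b}
  · rw [cutoffPotential_of_mem ht.1 ht.2, cutoffPotential_of_mem ht.1 ht.2]
    simp
  · simp only [cutoffPotential, indicator_of_notMem ht, star_zero]

theorem norm_cutoffPotential_sub_le (w : ℂ) (t : ℝ) :
    ‖cutoffPotential q b w t - cutoffPotential q b z t‖ ≤ ‖z - w‖ := by
  by_cases ht : t ∈ {x : ℝ | 0 < x ∧ (x : EReal) < b}
  · rw [cutoffPotential_of_mem ht.1 ht.2, cutoffPotential_of_mem ht.1 ht.2]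
    simp
  · simp [cutoffPotential, indicator_of_notMem ht]

theorem IsSquareIntegrable.conj (h : IsSquareIntegrable u) :
    IsSquareIntegrable fun t => star (u t) := by
  simpa only [IsSquareIntegrable, norm_star] using h

/-- By Lagrange's identity the Wronskian varies by the integral of (z - w) u v, which is finite for
square integrable u and v. -/
theorem wronskian_bounded (hq : ∀ c : ℝ, (c : EReal) ≤ ⊤ → IntegrableOn q (Ioo 0 c)) {w : ℂ}
    (h : IsGlobalSolution (cutoffPotential q ⊤ z) u du)
    (h' : IsGlobalSolution (cutoffPotential q ⊤ w) v dv)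
    (hu : IsSquareIntegrable u) (hv : IsSquareIntegrable v) :
    IsBoundedUnder (· ≤ ·) atTop (norm ∘ fun y => u y * dv y - du y * v y) := by
  refine isBoundedUnder_of_eventually_le (a := ‖u 0 * dv 0 - du 0 * v 0‖ +
    ∫ t in Ioi (0 : ℝ), ‖z - w‖ * (‖u t‖ ^ 2 + ‖v t‖ ^ 2)) ?_
  filter_upwards [eventually_ge_atTop 0] with y hy
  have h1 := h.wronskian_sub (intervalIntegrable_cutoffPotential hq)
    (intervalIntegrable_cutoffPotential hq) h' 0 y
  have hint : IntegrableOn (fun t => ‖z - w‖ * (‖u t‖ ^ 2 + ‖v t‖ ^ 2)) (Ioi 0) :=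
    (Integrable.add hu hv).const_mul _
  have h2 : ‖∫ t in (0 : ℝ)..y, (cutoffPotential q ⊤ w t - cutoffPotential q ⊤ z t) * (u t * v t)‖ ≤
      ∫ t in Ioi (0 : ℝ), ‖z - w‖ * (‖u t‖ ^ 2 + ‖v t‖ ^ 2) := by
    calc _ ≤ ∫ t in (0 : ℝ)..y, ‖z - w‖ * (‖u t‖ ^ 2 + ‖v t‖ ^ 2) := by
          refine intervalIntegral.norm_integral_le_of_norm_le hy
            (Eventually.of_forall fun t _ => ?_)
            ((intervalIntegrable_iff_integrableOn_Ioc_of_le hy).2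
              (hint.mono_set Ioc_subset_Ioi_self))
          rw [norm_mul, norm_mul]
          refine mul_le_mul (norm_cutoffPotential_sub_le _ _) ?_ (by positivity) (norm_nonneg _)
          nlinarith [sq_nonneg (‖u t‖ - ‖v t‖), sq_nonneg (‖u t‖ + ‖v t‖)]
      _ ≤ _ := by
          rw [intervalIntegral.integral_of_le hy]
          exact setIntegral_mono_set hint (Eventually.of_forall fun t => by positivity)
            Ioc_subset_Ioi_self.eventuallyLE
  rw [← h1] at h2
  have h3 := norm_add_le (u 0 * dv 0 - du 0 * v 0)
    ((u y * dv y - du y * v y) - (u 0 * dv 0 - du 0 * v 0))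
  rw [add_sub_cancel] at h3
  exact h3.trans (by gcongr)

/-- The Plücker identity W(f,g)W(h,k) = W(f,h)W(g,k) - W(f,k)W(g,h), with f = u₀ and a second
solution g = v for z = i, carries the condition from (u₀, u) to (ū₀, u) and then to (ū, u). The
remaining factors are bounded since all solutions are square integrable. -/
theorem im_conj_mul_deriv_nonneg_of_limitCircle
    (hq : ∀ c : ℝ, (c : EReal) ≤ ⊤ → IntegrableOn q (Ioo 0 c)) (hlc : IsLimitCircle q)
    (hz : 0 < z.im) (h : IsGlobalSolution (cutoffPotential q ⊤ z) u du) {u₀ du₀ : ℝ → ℂ}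
    (h₀ : IsGlobalSolution (cutoffPotential q ⊤ Complex.I) u₀ du₀) {x₀ : ℝ} (hne : u₀ x₀ ≠ 0)
    (hself : Tendsto (fun x => star (u₀ x) * du₀ x - star (du₀ x) * u₀ x) atTop (𝓝 0))
    (hbc : Tendsto (fun x => u₀ x * du x - du₀ x * u x) atTop (𝓝 0)) {y : ℝ} (hy : 0 ≤ y) :
    0 ≤ (star (u y) * du y).im := by
  have hI : 0 < Complex.I.im := by simp
  have hp : ∀ {z : ℂ}, ∀ x y, IntervalIntegrable (cutoffPotential q ⊤ z) volume x y := fun {z} =>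
    intervalIntegrable_cutoffPotential hq
  -- These initial values make the constant W(u₀, v) equal to |u₀(0)|² + |u₀'(0)|², which is
  -- nonzero.
  obtain ⟨v, dv, hv, hv0, hdv0⟩ := IsGlobalSolution.exists_of_initial
    (hp (z := Complex.I)) cutoffPotential_of_nonpos (-star (du₀ 0)) (star (u₀ 0))
  have hcw : ∀ x, u₀ x * dv x - du₀ x * v x = u₀ 0 * star (u₀ 0) + du₀ 0 * star (du₀ 0) := by
    intro x
    rw [h₀.wronskian_eq hp hv 0 x, hv0, hdv0]
    ring
  set c := u₀ 0 * star (u₀ 0) + du₀ 0 * star (du₀ 0) with hc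
  have hc0 : c ≠ 0 := by
    intro hzero
    have h1 : c = ((‖u₀ 0‖ ^ 2 + ‖du₀ 0‖ ^ 2 : ℝ) : ℂ) := by
      rw [hc, Complex.star_def, Complex.mul_conj', Complex.mul_conj']
      push_cast
      rfl
    rw [h1, Complex.ofReal_eq_zero] at hzero
    have h2 : u₀ 0 = 0 := norm_eq_zero.1 (by nlinarith [sq_nonneg ‖u₀ 0‖, sq_nonneg ‖du₀ 0‖])
    have h3 : du₀ 0 = 0 := norm_eq_zero.1 (by nlinarith [sq_nonneg ‖u₀ 0‖, sq_nonneg ‖du₀ 0‖])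
    exact hne (h₀.eq_zero_of_eq_zero hp cutoffPotential_of_nonpos h2 h3 x₀)
  have hL := hlc z hz u du h.isSchrodingerSolution
  have hL₀ := hlc _ hI u₀ du₀ h₀.isSchrodingerSolution
  have hLv := hlc _ hI v dv hv.isSchrodingerSolution
  have hconj := h.conj hp
  have hconj₀ := h₀.conj hp
  rw [star_cutoffPotential] at hconj hconj₀
  have b1 := wronskian_bounded hq hv h hLv hL
  have b2 := wronskian_bounded hq hv hconj₀ hLv hL₀.conj
  have b3 := wronskian_bounded hq hv hconj hLv hL.conj
  have hmix : Tendsto (fun x => star (u₀ x) * du x - star (du₀ x) * u x) atTop (𝓝 0) := by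
    have h1 := ((hself.zero_mul_isBoundedUnder_le b1).add
      (hbc.zero_mul_isBoundedUnder_le b2)).const_mul (-c⁻¹)
    rw [add_zero, mul_zero] at h1
    refine h1.congr fun x => ?_
    rw [neg_mul, ← mul_neg, inv_mul_eq_iff_eq_mul₀ hc0, ← hcw x]
    ring
  have hmix' : Tendsto (fun x => u₀ x * star (du x) - du₀ x * star (u x)) atTop (𝓝 0) := by
    have h1 := hmix.star
    rw [star_zero] at h1
    refine h1.congr fun x => ?_
    simp
  have hW : Tendsto (fun x => star (u x) * du x - u x * star (du x)) atTop (𝓝 0) := by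
    have h1 := ((hmix'.zero_mul_isBoundedUnder_le b1).sub
      (hbc.zero_mul_isBoundedUnder_le b3)).const_mul c⁻¹
    rw [sub_zero, mul_zero] at h1
    refine h1.congr fun x => ?_
    rw [inv_mul_eq_iff_eq_mul₀ hc0, ← hcw x]
    ring
  have hWim : Tendsto (fun x => 2 * (star (u x) * du x).im) atTop (𝓝 0) := by
    have h1 := (Complex.continuous_im.tendsto 0).comp hW
    rw [Complex.zero_im] at h1
    refine h1.congr fun x => ?_
    simp
    ring
  have : 0 ≤ 2 * (star (u y) * du y).im := by
    refine le_of_tendsto hWim ?_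
    filter_upwards [eventually_ge_atTop y] with t ht
    exact mul_le_mul_of_nonneg_left (h.im_conj_mul_deriv_anti hq hz hy ht le_top) zero_le_two
  linarith

theorem RightEnd.Admissible.integrableOn {B : RightEnd} (hB : B.Admissible q) :
    ∀ c : ℝ, (c : EReal) ≤ B.point → IntegrableOn q (Ioo 0 c) := by
  intro c hc
  cases B with
  | robin b h => exact IntegrableOn.mono_set hB (Ioo_subset_Ioo_right (EReal.coe_le_coe_iff.1 hc))
  | dirichlet b => exact IntegrableOn.mono_set hB (Ioo_subset_Ioo_right (EReal.coe_le_coe_iff.1 hc))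
  | limitPoint => exact hB.1 c
  | limitCircle u₀ du₀ => exact hB.1 c

/-- A Weyl solution extends to a global solution, and `Im (ū u') ≥ 0` up to the right endpoint. -/
theorem IsWeylSolution.exists_global {B : RightEnd} (hB : B.Admissible q) (hb : 0 < B.point)
    (hz : 0 < z.im) (h : IsWeylSolution q B z u du) :
    ∃ U dU : ℝ → ℂ, IsGlobalSolution (cutoffPotential q B.point z) U dU ∧
      (∀ x : ℝ, 0 ≤ x → (x : EReal) < B.point → u x = U x ∧ du x = dU x) ∧
      ∀ y : ℝ, 0 ≤ y → (y : EReal) ≤ B.point → 0 ≤ (star (U y) * dU y).im := by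
  have hq := hB.integrableOn
  obtain ⟨U, dU, hU, heq⟩ := h.solution.exists_global hq
  refine ⟨U, dU, hU, heq, fun y hy hyb => ?_⟩
  have hcond := h.condition
  -- By monotonicity it suffices at a finite endpoint that Im(ū u') vanishes at b itself.
  have hfin : ∀ b : ℝ, B.point = b → (star (U b) * dU b).im = 0 →
      0 ≤ (star (U y) * dU y).im := fun b hbp h0 => by
    rw [hbp] at hyb
    have := hU.im_conj_mul_deriv_anti hq hz hy (EReal.coe_le_coe_iff.1 hyb) hbp.ge
    rwa [h0] at this
  have hev : ∀ b : ℝ, B.point = b → ∀ᶠ x in 𝓝[<] b, u x = U x ∧ du x = dU x := fun b hbp => by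
    rw [hbp] at hb heq
    have hb0 : (0 : ℝ) < b := EReal.coe_lt_coe_iff.1 hb
    filter_upwards [Ioo_mem_nhdsLT hb0] with x hx
    exact heq x hx.1.le (EReal.coe_lt_coe_iff.2 hx.2)
  have hdUc := hU.continuous_deriv (intervalIntegrable_cutoffPotential hq)
  have hsq : IsSquareIntegrable u → B.point = ⊤ → IsSquareIntegrable U := fun hu htop => by
    refine IntegrableOn.congr_fun hu (fun x hx => ?_) measurableSet_Ioi
    simp only [(heq x (le_of_lt hx) (by rw [htop]; exact EReal.coe_lt_top x)).1]
  cases B with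
  | robin b r =>
    refine hfin b rfl ?_
    have h1 : Tendsto (fun x => dU x + (r : ℂ) * U x) (𝓝[<] b) (𝓝 (dU b + r * U b)) :=
      ((hdUc.add (continuous_const.mul hU.continuous)).tendsto b).mono_left nhdsWithin_le_nhds
    have h2 : Tendsto (fun x => dU x + (r : ℂ) * U x) (𝓝[<] b) (𝓝 0) := by
      refine Tendsto.congr' ?_ hcond
      filter_upwards [hev b rfl] with x hx
      rw [hx.1, hx.2]
    have h3 : dU b = -(r : ℂ) * U b := by
      linear_combination tendsto_nhds_unique h1 h2
    rw [h3]
    simp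
    ring
  | dirichlet b =>
    refine hfin b rfl ?_
    have h1 : Tendsto U (𝓝[<] b) (𝓝 (U b)) := (hU.continuous.tendsto b).mono_left nhdsWithin_le_nhds
    have h2 : Tendsto U (𝓝[<] b) (𝓝 0) := by
      refine Tendsto.congr' ?_ hcond
      filter_upwards [hev b rfl] with x hx using hx.1
    simp [tendsto_nhds_unique h1 h2]
  | limitPoint => exact im_conj_mul_deriv_nonneg_of_limitPoint hq hB.2 hz hU (hsq hcond rfl) hy
  | limitCircle u₀ du₀ =>
    obtain ⟨-, hlc, hsol₀, ⟨x₀, hx₀, -, hne⟩, hself⟩ := hB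
    obtain ⟨U₀, dU₀, hU₀, heq₀⟩ := hsol₀.exists_global hq
    have heq' : ∀ᶠ x : ℝ in atTop, (u₀ x = U₀ x ∧ du₀ x = dU₀ x) ∧ (u x = U x ∧ du x = dU x) := by
      filter_upwards [eventually_ge_atTop 0] with x hx
      exact ⟨heq₀ x hx (EReal.coe_lt_top x), heq x hx (EReal.coe_lt_top x)⟩
    refine im_conj_mul_deriv_nonneg_of_limitCircle hq hlc hz hU hU₀ (x₀ := x₀)
      (by rwa [← (heq₀ x₀ hx₀ (EReal.coe_lt_top x₀)).1]) (hself.congr' ?_) (Tendsto.congr' ?_ hcond) hy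
    · filter_upwards [heq'] with x hx
      rw [hx.1.1, hx.1.2]
    · filter_upwards [heq'] with x hx
      rw [hx.1.1, hx.1.2, hx.2.1, hx.2.2]

end Positivity

/-! ### Bounds in the sector and the choice of constants. -/

section Assembly

/-- Bounds for real and imaginary part in a sector of the fourth quadrant. -/
theorem sin_mul_norm_le_of_arg_mem {ε : ℝ} (hε : 0 < ε) {κ : ℂ}
    (hκ : κ.arg ∈ Ioo (-(Real.pi / 2) + ε) (-ε)) :
    0 < Real.sin ε ∧ Real.sin ε * ‖κ‖ ≤ κ.re ∧ Real.sin ε * ‖κ‖ ≤ -κ.im := by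
  have hε2 : ε < Real.pi / 2 := by linarith [hκ.1, hκ.2, Real.pi_pos]
  refine ⟨Real.sin_pos_of_pos_of_lt_pi hε (by linarith), ?_, ?_⟩
  · rw [← Complex.norm_mul_cos_arg κ, mul_comm]
    refine mul_le_mul_of_nonneg_left ?_ (norm_nonneg _)
    rw [← Real.sin_pi_div_two_sub, sub_eq_add_neg, ← Real.sin_pi_sub (Real.pi / 2 + -κ.arg)]
    exact Real.sin_le_sin_of_le_of_le_pi_div_two (by linarith) (by linarith [hκ.2])
      (by linarith [hκ.1])
  · rw [← Complex.norm_mul_sin_arg κ, mul_comm, ← mul_neg]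
    refine mul_le_mul_of_nonneg_left ?_ (norm_nonneg _)
    rw [← Real.sin_neg]
    exact Real.sin_le_sin_of_le_of_le_pi_div_two (by linarith) (by linarith [hκ.1])
      (by linarith [hκ.2])

theorem integral_norm_cutoffPotential_le {q : ℝ → ℝ} {b : EReal} {z : ℂ} {x s δ η : ℝ}
    (hq : ∀ c : ℝ, (c : EReal) ≤ b → IntegrableOn q (Ioo 0 c)) (hx : 0 ≤ x) (hs : 0 ≤ s)
    (hsδ : s ≤ δ) (hxb : ((x + δ : ℝ) : EReal) ≤ b) (hη : ∫ t in x..(x + δ), |q t| ≤ η) :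
    ∫ t in x..(x + s), ‖cutoffPotential q b z t‖ ≤ η + s * ‖z‖ := by
  have hxs : x ≤ x + s := by linarith
  have hqi : IntervalIntegrable (fun t => |q t|) volume x (x + δ) := by
    rw [intervalIntegrable_iff_integrableOn_Ioo_of_le (by linarith)]
    exact ((hq _ hxb).mono_set (Ioo_subset_Ioo_left hx)).abs
  have hqs : IntervalIntegrable (fun t => |q t|) volume x (x + s) := by
    refine hqi.mono_set ?_
    rw [uIcc_of_le hxs, uIcc_of_le (by linarith)]
    exact Icc_subset_Icc_right (by linarith)
  calc ∫ t in x..(x + s), ‖cutoffPotential q b z t‖ ≤ ∫ t in x..(x + s), (|q t| + ‖z‖) := by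
        refine intervalIntegral.integral_mono_on_of_le_Ioo hxs
          (intervalIntegrable_cutoffPotential hq _ _).norm (hqs.add intervalIntegrable_const)
          fun t ht => ?_
        have htb : (t : EReal) < b :=
          (EReal.coe_lt_coe_iff.2 (by linarith [ht.2] : t < x + δ)).trans_le hxb
        rw [cutoffPotential_of_mem (hx.trans_lt ht.1) htb]
        refine (norm_sub_le _ _).trans_eq ?_
        rw [Complex.norm_real, Real.norm_eq_abs]
    _ = (∫ t in x..(x + s), |q t|) + s * ‖z‖ := by
        rw [intervalIntegral.integral_add hqs intervalIntegrable_const,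
          intervalIntegral.integral_const, smul_eq_mul, add_sub_cancel_left]
    _ ≤ η + s * ‖z‖ := by
        gcongr
        exact (intervalIntegral.integral_mono_interval le_rfl hxs (by linarith)
          (Eventually.of_forall fun _ => abs_nonneg _) hqi).trans hη

/-- If the Cayley-type transform of `c / a` is at most `C / |κ| ≤ 1 / 2`, then `c / a` is within
`4 C` of `-κ`. -/
theorem norm_add_le_of_norm_add_le_mul {a c κ : ℂ} {C : ℝ} (hκ : 0 < ‖κ‖) (hC : 2 * C ≤ ‖κ‖)
    (hC0 : 0 ≤ C) (h : ‖c + κ * a‖ ≤ C / ‖κ‖ * ‖c - κ * a‖) : ‖c + κ * a‖ ≤ 4 * C * ‖a‖ := by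
  have h1 : ‖c - κ * a‖ ≤ ‖c + κ * a‖ + 2 * (‖κ‖ * ‖a‖) := by
    calc ‖c - κ * a‖ = ‖(c + κ * a) - 2 * (κ * a)‖ := by congr 1; ring
      _ ≤ _ := (norm_sub_le _ _).trans_eq (by simp)
  have h2 : C / ‖κ‖ ≤ 1 / 2 := by
    rw [div_le_div_iff₀ hκ two_pos]; linarith
  have h3 : ‖c + κ * a‖ ≤ C / ‖κ‖ * ‖c + κ * a‖ + 2 * (C * ‖a‖) := by
    calc _ ≤ C / ‖κ‖ * (‖c + κ * a‖ + 2 * (‖κ‖ * ‖a‖)) := h.trans (by gcongr)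
      _ = _ := by field_simp
  -- Half of ‖c + κa‖ is absorbed into the left side.
  nlinarith [mul_le_mul_of_nonneg_right h2 (norm_nonneg (c + κ * a))]

end Assembly

theorem theorem1p4 (ε δ K₀ η : ℝ) (hε : 0 < ε) (hδ : 0 < δ) (hK₀ : 0 < K₀) :
    ∃ C : ℝ, ∀ (a : ℝ) (q : ℝ → ℝ) (B : RightEnd),
      0 ≤ a → ((a + δ : ℝ) : EReal) ≤ B.point → B.Admissible q →
      (∀ x ∈ Set.Icc (0 : ℝ) a, (∫ y in x..(x + δ), |q y|) ≤ η) →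
      ∀ κ : ℂ, κ.arg ∈ Set.Ioo (-(Real.pi / 2) + ε) (-ε) → K₀ ≤ ‖κ‖ →
      ∀ u du : ℝ → ℂ, IsWeylSolution q B (-κ ^ 2) u du →
      ∀ x ∈ Set.Icc (0 : ℝ) a, u x ≠ 0 ∧ ‖du x / u x + κ‖ ≤ C := by
  -- The constants are fixed before κ; σ > 0 is known only once some κ lies in the sector. `C₁` is
  -- the constant for large |κ|, with |η| to keep it nonnegative. `N` bounds the integral of |q - z|
  -- over length s ≤ 1 when |κ| ≤ 2C₁, `s` ensures N s ≤ 1/4, and `θ` bounds Im z = -2 Re κ Im κ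
  -- from below.
  set σ := Real.sin ε with hσdef
  set C₁ := (1 + 2 / σ) / (2 * σ * δ) + 2 * |η| / σ ^ 2 with hC₁
  set N := |η| + (2 * C₁) ^ 2 with hN
  set s := min (min δ 1) (1 / (4 * (N + 1))) with hs
  set θ := 2 * K₀ ^ 2 * σ ^ 2 with hθ
  set C₂ := 12 / s + 72 / (θ * s ^ 3) with hC₂
  refine ⟨4 * C₁ + (C₂ + 2 * C₁), ?_⟩
  intro a q B ha haB hB hη κ hκ hK u du hu x hx
  obtain ⟨hσ, hre, him⟩ := sin_mul_norm_le_of_arg_mem hε hκ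
  have hC₁0 : 0 ≤ C₁ := by positivity
  have hN0 : 0 ≤ N := by positivity
  have hs0 : 0 < s := lt_min (lt_min hδ one_pos) (by positivity)
  have hsδ : s ≤ δ := (min_le_left _ _).trans (min_le_left _ _)
  have hs1 : s ≤ 1 := (min_le_left _ _).trans (min_le_right _ _)
  have hNs : N * s ≤ 1 / 4 := by
    calc N * s ≤ N * (1 / (4 * (N + 1))) := mul_le_mul_of_nonneg_left (min_le_right _ _) hN0
      _ ≤ 1 / 4 := by
        rw [mul_one_div, div_le_div_iff₀ (by positivity) (by norm_num)]
        linarith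
  have hθ0 : 0 < θ := by positivity
  have hC₂0 : 0 ≤ C₂ := by positivity
  have hκ0 : 0 < ‖κ‖ := hK₀.trans_le hK
  have hzθ : θ ≤ (-κ ^ 2).im := by
    have h1 : (-κ ^ 2).im = 2 * (κ.re * -κ.im) := by
      rw [Complex.neg_im, sq, Complex.mul_im]; ring
    rw [h1]
    have h2 : σ * K₀ ≤ σ * ‖κ‖ := mul_le_mul_of_nonneg_left hK hσ.le
    have h3 : σ * K₀ * (σ * K₀) ≤ κ.re * -κ.im :=
      mul_le_mul (h2.trans hre) (h2.trans him) (by positivity)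
        ((mul_nonneg hσ.le hκ0.le).trans hre)
    linarith
  have hz : 0 < (-κ ^ 2).im := hθ0.trans_le hzθ
  have hq := hB.integrableOn
  have hb : 0 < B.point :=
    (EReal.coe_lt_coe_iff.2 (by linarith : (0 : ℝ) < a + δ)).trans_le haB
  have hxδ : ((x + δ : ℝ) : EReal) ≤ B.point :=
    (EReal.coe_le_coe_iff.2 (by linarith [hx.2])).trans haB
  have hle : ∀ {y : ℝ}, y ≤ x + δ → (y : EReal) ≤ B.point := fun hy =>
    (EReal.coe_le_coe_iff.2 hy).trans hxδ
  obtain ⟨U, dU, hU, heq, hW⟩ := hu.exists_global hB hb hz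
  have hp : ∀ x y, IntervalIntegrable (cutoffPotential q B.point (-κ ^ 2)) volume x y :=
    intervalIntegrable_cutoffPotential hq
  obtain ⟨x₀, hx₀, hx₀b, hne₀⟩ := hu.nontrivial
  rw [(heq x₀ hx₀ hx₀b).1] at hne₀
  obtain ⟨hux, hdux⟩ := heq x hx.1
    ((EReal.coe_lt_coe_iff.2 (by linarith : x < x + δ)).trans_le hxδ)
  rw [hux, hdux]
  have hηx : ∫ t in x..(x + δ), |q t| ≤ |η| := (hη x hx).trans (le_abs_self η)
  -- Im(ū u') is nonnegative at x + δ and strictly larger at x.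
  have hUx : U x ≠ 0 := by
    intro h0
    have h1 := hU.im_conj_mul_deriv hq hx.1 (by linarith : x ≤ x + δ) hxδ
    have h2 := mul_pos hz (hU.integral_norm_sq_pos hp cutoffPotential_of_nonpos hne₀
      (by linarith : x < x + δ))
    have h3 := hW (x + δ) (by linarith [hx.1]) hxδ
    rw [h0, star_zero, zero_mul, Complex.zero_im] at h1
    linarith
  refine ⟨hUx, ?_⟩
  have hUx' : 0 < ‖U x‖ := norm_pos_iff.2 hUx
  -- Above the threshold |ρ| ≤ 1/2 and the bound is 4C₁; below it |m| ≤ C₂ and |κ| ≤ 2C₁.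
  rcases le_total (2 * C₁) ‖κ‖ with hlarge | hsmall
  · have h1 := hU.norm_add_le_mul_norm_sub hq hx.1 hδ hxδ hσ hκ0 hre him
      (fun t ht => hW t (hx.1.trans ht.1) (hle ht.2))
      (fun t h0 h0' => hne₀ (hU.eq_zero_of_eq_zero hp cutoffPotential_of_nonpos h0 h0' x₀)) hηx
    have h2 := norm_add_le_of_norm_add_le_mul hκ0 hlarge hC₁0 h1
    have h3 : dU x / U x + κ = (dU x + κ * U x) / U x := by field_simp
    have h4 : ‖dU x / U x + κ‖ ≤ 4 * C₁ := by
      rw [h3, norm_div, div_le_iff₀ hUx']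
      exact h2
    linarith
  · have h1 : ‖dU x‖ ≤ C₂ * ‖U x‖ := by
      refine hU.norm_deriv_le hp hs0 (N := N) ?_ hNs hθ0 ?_
      · refine (integral_norm_cutoffPotential_le hq hx.1 hs0.le hsδ hxδ hηx).trans ?_
        rw [norm_neg, norm_pow, hN]
        have h2 : ‖κ‖ ^ 2 ≤ (2 * C₁) ^ 2 := pow_le_pow_left₀ hκ0.le hsmall 2
        have h3 : s * ‖κ‖ ^ 2 ≤ 1 * ‖κ‖ ^ 2 := mul_le_mul_of_nonneg_right hs1 (by positivity)
        linarith
      · have h2 := hU.im_conj_mul_deriv hq hx.1 (by linarith : x ≤ x + s) (hle (by linarith))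
        have h3 := hW (x + s) (by linarith [hx.1]) (hle (by linarith))
        have h4 : 0 ≤ ∫ t in x..(x + s), ‖U t‖ ^ 2 :=
          intervalIntegral.integral_nonneg (by linarith) fun _ _ => by positivity
        have h5 := mul_le_mul_of_nonneg_right hzθ h4
        linarith
    have h2 : ‖dU x / U x‖ ≤ C₂ := by
      rw [norm_div, div_le_iff₀ hUx']
      exact h1
    have h3 := norm_add_le (dU x / U x) κ
    linarith
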